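/- Consider a model $\mathcal M$ of extensional dependent type theory: a category with families over an arbitrary category $\mathcal C$ of contexts (types and terms with strictly functorial substitution, an empty context $1$, context extension $\Gamma.A$), with dependent products and sums ($\beta$ and $\eta$), extensional equality types (equality reflection and uniqueness of equality proofs), empty, unit and boolean types, and $W$-types with dependent elimination, everything strictly stable under substitution. A \emph{strictly cumulative hierarchy} in $\mathcal M$ consists of closed types $U_0,U_1,U_2,\dots$ with decoding families $A:U_i\vdash \mathrm{El}_i(A)$ and coercions $\uparrow_i^j:U_i\to U_j$ for $i\le j$, such that: each $U_i$ has codes for $\Pi$-, $\Sigma$-, $W$- and equality types (of codes and families of codes), for the empty, unit and boolean types, and for each $U_k$ with $k<i$; all of this is stable under substitution; $\mathrm{El}_i$ sends each code, up to strict equality, to the type it stands for; and the coercions are functorial ($\uparrow_i^i=\mathrm{id}$, $\uparrow_j^k\uparrow_i^j=\uparrow_i^k$), satisfy $\mathrm{El}_j(\uparrow_i^j A)=\mathrm{El}_i(A)$, and commute strictly with all codes. Its $i$-th \emph{generic family} is the projection $1.(A:U_i).\mathrm{El}_i(A)\to 1.U_i$, and $U_i$ is \emph{generic for} the class of those morphisms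 of $\mathcal C$ that are pullbacks of this projection. \textbf{Theorem.} Let $U$ be a strictly cumulative hierarchy in $\mathcal M$. Then there is a strictly cumulative hierarchy $V$ in the same model $\mathcal M$ such that: 1. the codes of $V$ are injective: for every $i$ and in every context, each of the code-forming operations of $V_i$ for $\Pi$-, $\Sigma$-, $W$- and equality types is injective in all its arguments jointly, e.g. $\mathsf{pi}(A,B)=\mathsf{pi}(A',B')$ implies $A=A'$ and $B=B'$; 2. for every $i$, $V_i$ is generic for the same class of morphisms of $\mathcal C$ as $U_i$; moreover a type $A$ in a context $\Gamma$ is strictly equal to the decoding of some term of $V_i$ in context $\Gamma$ if and only if it is strictly equal to the decoding of some term of $U_i$ in context $\Gamma$; 3. there are functions $\mathsf{Up}_i:U_i\to V_i$ and $\mathsf{Dec}_i:V_i\to U_i$, stable under substitution, with $\mathsf{Dec}_i\circ\mathsf{Up}_i=\mathrm{id}$ and $\mathrm{El}^V_i(A)=\mathrm{El}^U_i(\mathsf{Dec}_i(A))$, both commuting with the coercions, where $\mathsf{Dec}_i$ sends the codes of $V_i$ for $\Pi$-, $\Sigma$-, $W$-, equality, empty, unit and boolean types to the corresponding codes of $U_i$.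 -/

import Mathlib

open CategoryTheory

universe u v w w'

/-- A model of dependent type theory without type formers (a category with families, presented as a
natural model): contexts and substitutions form the category `C`; `Ty Γ` and `Tm Γ` are the types
and the terms in context `Γ`, every term `t` having the type `tp t`; types and terms are acted on
strictly functorially by substitutions; there is an empty context, and every context can be
extended by a type. -/
structure NatModel (C : Type u) [Category.{v} C] where
  Ty : C → Type w
  Tm : C → Type w'
  tp {Γ : C} : Tm Γ → Ty Γ
  tySub {Γ Δ : C} (σ : Δ ⟶ Γ) : Ty Γ → Ty Δ
  tmSub {Γ Δ : C} (σ : Δ ⟶ Γ) : Tm Γ → Tm Δ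
  tySub_id {Γ : C} (A : Ty Γ) : tySub (𝟙 Γ) A = A
  tySub_comp {Γ Δ Θ : C} (τ : Θ ⟶ Δ) (σ : Δ ⟶ Γ) (A : Ty Γ) :
    tySub (τ ≫ σ) A = tySub τ (tySub σ A)
  tmSub_id {Γ : C} (t : Tm Γ) : tmSub (𝟙 Γ) t = t
  tmSub_comp {Γ Δ Θ : C} (τ : Θ ⟶ Δ) (σ : Δ ⟶ Γ) (t : Tm Γ) :
    tmSub (τ ≫ σ) t = tmSub τ (tmSub σ t)
  tp_tmSub {Γ Δ : C} (σ : Δ ⟶ Γ) (t : Tm Γ) : tp (tmSub σ t) = tySub σ (tp t)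
  /-- the empty context -/
  nil : C
  nilTerminal : Limits.IsTerminal nil
  /-- context extension `Γ.A` -/
  ext (Γ : C) (A : Ty Γ) : C
  /-- the weakening substitution `Γ.A ⟶ Γ` -/
  wk {Γ : C} (A : Ty Γ) : ext Γ A ⟶ Γ
  /-- the last variable of `Γ.A` -/
  var {Γ : C} (A : Ty Γ) : Tm (ext Γ A)
  tp_var {Γ : C} (A : Ty Γ) : tp (var A) = tySub (wk A) A
  /-- the extended substitution `⟨σ, a⟩ : Δ ⟶ Γ.A` -/
  cons {Γ Δ : C} (σ : Δ ⟶ Γ) (A : Ty Γ) (a : Tm Δ) (h : tp a = tySub σ A) : Δ ⟶ ext Γ A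
  cons_wk {Γ Δ : C} (σ : Δ ⟶ Γ) (A : Ty Γ) (a : Tm Δ) (h : tp a = tySub σ A) :
    cons σ A a h ≫ wk A = σ
  var_cons {Γ Δ : C} (σ : Δ ⟶ Γ) (A : Ty Γ) (a : Tm Δ) (h : tp a = tySub σ A) :
    tmSub (cons σ A a h) (var A) = a
  cons_eta {Γ Δ : C} (A : Ty Γ) (τ : Δ ⟶ ext Γ A)
    (h : tp (tmSub τ (var A)) = tySub (τ ≫ wk A) A) :
    cons (τ ≫ wk A) A (tmSub τ (var A)) h = τ

namespace NatModel

variable {C : Type u} [Category.{v} C] (M : NatModel.{u, v, w, w'} C)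

/-- The terms `Γ ⊢ t : A`. -/
def Term {Γ : C} (A : M.Ty Γ) : Type w' := {t : M.Tm Γ // M.tp t = A}

/-- Substitution on typed terms; the type `A'` of the result may be any type equal to `A[σ]`. -/
def sub {Γ Δ : C} (σ : Δ ⟶ Γ) {A : M.Ty Γ} {A' : M.Ty Δ} (h : M.tySub σ A = A')
    (t : M.Term A) : M.Term A' :=
  ⟨M.tmSub σ t.1, by rw [M.tp_tmSub, t.2, h]⟩

/-- A term of type `A` regarded as a term of the equal type `A'`. -/
def castTm {Γ : C} {A A' : M.Ty Γ} (h : A = A') (t : M.Term A) : M.Term A' :=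
  ⟨t.1, t.2.trans h⟩

/-- The substitution `⟨id, a⟩ : Γ ⟶ Γ.A`. -/
def inst {Γ : C} {A : M.Ty Γ} (a : M.Term A) : Γ ⟶ M.ext Γ A :=
  M.cons (𝟙 Γ) A a.1 (by rw [a.2, M.tySub_id])

/-- The substitution `σ.A : Δ.A' ⟶ Γ.A` under a variable, where `A' = A[σ]`. -/
def lift {Γ Δ : C} (σ : Δ ⟶ Γ) {A : M.Ty Γ} {A' : M.Ty Δ} (h : M.tySub σ A = A') :
    M.ext Δ A' ⟶ M.ext Γ A :=
  M.cons (M.wk A' ≫ σ) A (M.var A') (by rw [M.tp_var, M.tySub_comp, h])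

/-- The identity substitution `Γ.A' ⟶ Γ.A` for equal types `A` and `A'`. -/
def castCtx {Γ : C} {A A' : M.Ty Γ} (h : A = A') : M.ext Γ A' ⟶ M.ext Γ A :=
  M.lift (𝟙 Γ) ((M.tySub_id A).trans h)

theorem hom_ext {Γ Δ : C} {A : M.Ty Γ} {τ τ' : Δ ⟶ M.ext Γ A}
    (h₁ : τ ≫ M.wk A = τ' ≫ M.wk A) (h₂ : M.tmSub τ (M.var A) = M.tmSub τ' (M.var A)) :
    τ = τ' := by
  have e : ∀ ρ : Δ ⟶ M.ext Γ A, M.tp (M.tmSub ρ (M.var A)) = M.tySub (ρ ≫ M.wk A) A := by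
    intro ρ
    rw [M.tp_tmSub, M.tp_var, M.tySub_comp]
  rw [← M.cons_eta A τ (e τ), ← M.cons_eta A τ' (e τ')]
  congr 1

theorem comp_cons {Γ Δ Θ : C} (τ : Θ ⟶ Δ) (σ : Δ ⟶ Γ) (A : M.Ty Γ) (a : M.Tm Δ)
    (h : M.tp a = M.tySub σ A) :
    τ ≫ M.cons σ A a h = M.cons (τ ≫ σ) A (M.tmSub τ a)
      (by rw [M.tp_tmSub, h, M.tySub_comp]) := by
  apply M.hom_ext
  · rw [Category.assoc, M.cons_wk, M.cons_wk]
  · rw [M.tmSub_comp, M.var_cons, M.var_cons]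

theorem lift_wk {Γ Δ : C} (σ : Δ ⟶ Γ) {A : M.Ty Γ} {A' : M.Ty Δ} (h : M.tySub σ A = A') :
    M.lift σ h ≫ M.wk A = M.wk A' ≫ σ :=
  M.cons_wk _ _ _ _

theorem cons_lift {Γ Δ Θ : C} (τ : Θ ⟶ Δ) (σ : Δ ⟶ Γ) {A : M.Ty Γ} {A' : M.Ty Δ}
    (h : M.tySub σ A = A') (a : M.Tm Θ) (ha : M.tp a = M.tySub τ A') :
    M.cons τ A' a ha ≫ M.lift σ h =
      M.cons (τ ≫ σ) A a (by rw [ha, ← h, M.tySub_comp]) := by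
  apply M.hom_ext
  · rw [Category.assoc, M.lift_wk, ← Category.assoc, M.cons_wk, M.cons_wk]
  · rw [M.tmSub_comp, lift, M.var_cons, M.var_cons, M.var_cons]

theorem inst_comp {Γ Δ : C} (σ : Δ ⟶ Γ) {A : M.Ty Γ} {A' : M.Ty Δ} (h : M.tySub σ A = A')
    (a : M.Term A) : σ ≫ M.inst a = M.inst (M.sub σ h a) ≫ M.lift σ h := by
  apply M.hom_ext
  · simp only [inst, Category.assoc, lift_wk, cons_wk, Category.comp_id]
    rw [← Category.assoc, M.cons_wk, Category.id_comp]
  · rw [M.tmSub_comp, M.tmSub_comp, inst, lift, inst, M.var_cons, M.var_cons, M.var_cons, sub]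

/-- `B[a][σ] = B[σ.A][a[σ]]`. -/
theorem tySub_inst {Γ Δ : C} (σ : Δ ⟶ Γ) {A : M.Ty Γ} (B : M.Ty (M.ext Γ A)) (a : M.Term A) :
    M.tySub σ (M.tySub (M.inst a) B) =
      M.tySub (M.inst (M.sub σ rfl a)) (M.tySub (M.lift σ rfl) B) := by
  rw [← M.tySub_comp, ← M.tySub_comp, ← M.inst_comp]

/-- `B[σ.A][a][τ] = B[(σ ∘ τ).A][a[τ]]`. -/
theorem tySub_lift_inst {Γ Δ Θ : C} (τ : Θ ⟶ Δ) (σ : Δ ⟶ Γ) {A : M.Ty Γ}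
    (B : M.Ty (M.ext Γ A)) (a : M.Term (M.tySub σ A)) :
    M.tySub τ (M.tySub (M.inst a) (M.tySub (M.lift σ rfl) B)) =
      M.tySub (M.inst (M.sub τ (M.tySub_comp τ σ A).symm a))
        (M.tySub (M.lift (τ ≫ σ) rfl) B) := by
  simp only [← M.tySub_comp]
  congr 1
  rw [inst, inst, M.cons_lift, M.cons_lift, M.comp_cons]
  apply M.hom_ext
  · simp only [cons_wk, Category.id_comp]
  · simp only [var_cons, sub]

/-- `D[wk][τ.E] = D[τ][wk]`. -/
theorem tySub_wk_lift {Γ Δ : C} (τ : Δ ⟶ Γ) {E : M.Ty Γ} {E' : M.Ty Δ}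
    (h : M.tySub τ E = E') {D : M.Ty Γ} {D' : M.Ty Δ} (hD : M.tySub τ D = D') :
    M.tySub (M.lift τ h) (M.tySub (M.wk E) D) = M.tySub (M.wk E') D' := by
  rw [← M.tySub_comp, M.lift_wk, M.tySub_comp, hD]

/-- Dependent products. Application, with its `β` and `η` laws, is the inverse of abstraction. -/
structure PiTypes where
  Pi {Γ : C} (A : M.Ty Γ) (B : M.Ty (M.ext Γ A)) : M.Ty Γ
  Pi_sub {Γ Δ : C} (σ : Δ ⟶ Γ) (A : M.Ty Γ) (B : M.Ty (M.ext Γ A)) :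
    M.tySub σ (Pi A B) = Pi (M.tySub σ A) (M.tySub (M.lift σ rfl) B)
  lam {Γ : C} {A : M.Ty Γ} {B : M.Ty (M.ext Γ A)} (b : M.Term B) : M.Term (Pi A B)
  lam_sub {Γ Δ : C} (σ : Δ ⟶ Γ) {A : M.Ty Γ} {B : M.Ty (M.ext Γ A)} (b : M.Term B) :
    M.sub σ (Pi_sub σ A B) (lam b) = lam (M.sub (M.lift σ rfl) rfl b)
  lam_bijective {Γ : C} (A : M.Ty Γ) (B : M.Ty (M.ext Γ A)) :
    Function.Bijective (lam : M.Term B → M.Term (Pi A B))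

/-- Dependent sums. The projections, with their `β` and `η` laws, are the inverse of pairing. -/
structure SigmaTypes where
  Sig {Γ : C} (A : M.Ty Γ) (B : M.Ty (M.ext Γ A)) : M.Ty Γ
  Sig_sub {Γ Δ : C} (σ : Δ ⟶ Γ) (A : M.Ty Γ) (B : M.Ty (M.ext Γ A)) :
    M.tySub σ (Sig A B) = Sig (M.tySub σ A) (M.tySub (M.lift σ rfl) B)
  pair {Γ : C} {A : M.Ty Γ} {B : M.Ty (M.ext Γ A)} (a : M.Term A)
    (b : M.Term (M.tySub (M.inst a) B)) : M.Term (Sig A B)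
  pair_sub {Γ Δ : C} (σ : Δ ⟶ Γ) {A : M.Ty Γ} {B : M.Ty (M.ext Γ A)} (a : M.Term A)
    (b : M.Term (M.tySub (M.inst a) B)) :
    M.sub σ (Sig_sub σ A B) (pair a b) =
      pair (M.sub σ rfl a) (M.sub σ (M.tySub_inst σ B a) b)
  pair_bijective {Γ : C} (A : M.Ty Γ) (B : M.Ty (M.ext Γ A)) :
    Function.Bijective
      (fun x : (Σ a : M.Term A, M.Term (M.tySub (M.inst a) B)) => (pair x.1 x.2 : M.Term (Sig A B)))

/-- Extensional equality types: equality reflection and uniqueness of equality proofs. -/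
structure EqTypes where
  EqTy {Γ : C} {A : M.Ty Γ} (s t : M.Term A) : M.Ty Γ
  EqTy_sub {Γ Δ : C} (σ : Δ ⟶ Γ) {A : M.Ty Γ} (s t : M.Term A) :
    M.tySub σ (EqTy s t) = EqTy (M.sub σ rfl s) (M.sub σ rfl t)
  refl {Γ : C} {A : M.Ty Γ} (s : M.Term A) : M.Term (EqTy s s)
  reflection {Γ : C} {A : M.Ty Γ} {s t : M.Term A} (e : M.Term (EqTy s t)) : s = t
  uip {Γ : C} {A : M.Ty Γ} {s t : M.Term A} (e e' : M.Term (EqTy s t)) : e = e'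

/-- The empty, unit and boolean types. As equality is extensional, the dependent eliminators are
uniquely determined (and therefore stable under substitution), so that they are given by unique
existence. -/
structure FiniteTypes where
  Zero (Γ : C) : M.Ty Γ
  Zero_sub {Γ Δ : C} (σ : Δ ⟶ Γ) : M.tySub σ (Zero Γ) = Zero Δ
  zero_elim {Γ : C} (D : M.Ty (M.ext Γ (Zero Γ))) : ∃! _r : M.Term D, True
  One (Γ : C) : M.Ty Γ
  One_sub {Γ Δ : C} (σ : Δ ⟶ Γ) : M.tySub σ (One Γ) = One Δ
  star (Γ : C) : M.Term (One Γ)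
  star_unique {Γ : C} (t : M.Term (One Γ)) : t = star Γ
  Two (Γ : C) : M.Ty Γ
  Two_sub {Γ Δ : C} (σ : Δ ⟶ Γ) : M.tySub σ (Two Γ) = Two Δ
  tt (Γ : C) : M.Term (Two Γ)
  tt_sub {Γ Δ : C} (σ : Δ ⟶ Γ) : M.sub σ (Two_sub σ) (tt Γ) = tt Δ
  ff (Γ : C) : M.Term (Two Γ)
  ff_sub {Γ Δ : C} (σ : Δ ⟶ Γ) : M.sub σ (Two_sub σ) (ff Γ) = ff Δ
  two_elim {Γ : C} (D : M.Ty (M.ext Γ (Two Γ)))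
    (d₁ : M.Term (M.tySub (M.inst (tt Γ)) D)) (d₀ : M.Term (M.tySub (M.inst (ff Γ)) D)) :
    ∃! r : M.Term D, M.sub (M.inst (tt Γ)) rfl r = d₁ ∧ M.sub (M.inst (ff Γ)) rfl r = d₀

/-- Formation and introduction of `W`-types. The family of subtrees of `sup a f` is given as an
open term `Γ, x : B[a] ⊢ f : W A B`. -/
structure WFormers where
  W {Γ : C} (A : M.Ty Γ) (B : M.Ty (M.ext Γ A)) : M.Ty Γ
  W_sub {Γ Δ : C} (σ : Δ ⟶ Γ) (A : M.Ty Γ) (B : M.Ty (M.ext Γ A)) :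
    M.tySub σ (W A B) = W (M.tySub σ A) (M.tySub (M.lift σ rfl) B)
  sup {Γ : C} {A : M.Ty Γ} {B : M.Ty (M.ext Γ A)} (a : M.Term A)
    (f : M.Term (M.tySub (M.wk (M.tySub (M.inst a) B)) (W A B))) : M.Term (W A B)
  sup_sub {Γ Δ : C} (σ : Δ ⟶ Γ) {A : M.Ty Γ} {B : M.Ty (M.ext Γ A)} (a : M.Term A)
    (f : M.Term (M.tySub (M.wk (M.tySub (M.inst a) B)) (W A B))) :
    M.sub σ (W_sub σ A B) (sup a f) =
      sup (M.sub σ rfl a)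
        (M.sub (M.lift σ (M.tySub_inst σ B a)) (M.tySub_wk_lift σ _ (W_sub σ A B)) f)

namespace WFormers

variable {M} (T : M.WFormers) {Γ : C} {A : M.Ty Γ} {B : M.Ty (M.ext Γ A)}

/-- The `W`-type `W A B` in a context `Δ` over `Γ`. -/
abbrev WAt {Δ : C} (B : M.Ty (M.ext Γ A)) (σ : Δ ⟶ Γ) : M.Ty Δ :=
  T.W (M.tySub σ A) (M.tySub (M.lift σ rfl) B)

/-- The arity `B[σ, a]` of a label `a` in a context `Δ` over `Γ`. -/
abbrev Arity {Δ : C} (B : M.Ty (M.ext Γ A)) (σ : Δ ⟶ Γ) (a : M.Term (M.tySub σ A)) : M.Ty Δ :=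
  M.tySub (M.inst a) (M.tySub (M.lift σ rfl) B)

/-- The substitution `⟨σ, t⟩ : Δ ⟶ Γ.(W A B)`. -/
def consTree {Δ : C} (σ : Δ ⟶ Γ) (t : M.Term (T.WAt B σ)) : Δ ⟶ M.ext Γ (T.W A B) :=
  M.cons σ (T.W A B) t.1 (t.2.trans (T.W_sub σ A B).symm)

/-- The substitution `⟨σ, f⟩ : Δ.E ⟶ Γ.(W A B)` for a family `f` of trees indexed by `E`. -/
def consFam {Δ : C} (σ : Δ ⟶ Γ) {E : M.Ty Δ} (f : M.Term (M.tySub (M.wk E) (T.WAt B σ))) :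
    M.ext Δ E ⟶ M.ext Γ (T.W A B) :=
  M.cons (M.wk E ≫ σ) (T.W A B) f.1 (by rw [f.2, M.tySub_comp, T.W_sub σ])

theorem WAt_sub {Δ Θ : C} (τ : Θ ⟶ Δ) (σ : Δ ⟶ Γ) :
    M.tySub τ (T.WAt B σ) = T.WAt B (τ ≫ σ) := by
  rw [WAt, WAt, ← T.W_sub, ← T.W_sub, M.tySub_comp]

/-- Restriction of a label along `τ`. -/
abbrev labelSub {Δ Θ : C} (τ : Θ ⟶ Δ) (σ : Δ ⟶ Γ) (a : M.Term (M.tySub σ A)) :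
    M.Term (M.tySub (τ ≫ σ) A) :=
  M.sub τ (M.tySub_comp τ σ A).symm a

/-- The substitution `τ.B[a] : Θ.B[a[τ]] ⟶ Δ.B[a]`. -/
def arityLift {Δ Θ : C} (B : M.Ty (M.ext Γ A)) (τ : Θ ⟶ Δ) (σ : Δ ⟶ Γ)
    (a : M.Term (M.tySub σ A)) :
    M.ext Θ (Arity B (τ ≫ σ) (labelSub τ σ a)) ⟶ M.ext Δ (Arity B σ a) :=
  M.lift τ (M.tySub_lift_inst τ σ B a)

/-- Restriction of a family of subtrees along `τ`. -/
def famSub {Δ Θ : C} (τ : Θ ⟶ Δ) (σ : Δ ⟶ Γ) (a : M.Term (M.tySub σ A))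
    (f : M.Term (M.tySub (M.wk (Arity B σ a)) (T.WAt B σ))) :
    M.Term (M.tySub (M.wk (Arity B (τ ≫ σ) (labelSub τ σ a))) (T.WAt B (τ ≫ σ))) :=
  M.sub (arityLift B τ σ a) (M.tySub_wk_lift τ _ (T.WAt_sub τ σ)) f

theorem comp_consFam {Δ Θ : C} (τ : Θ ⟶ Δ) (σ : Δ ⟶ Γ) (a : M.Term (M.tySub σ A))
    (f : M.Term (M.tySub (M.wk (Arity B σ a)) (T.WAt B σ))) :
    arityLift B τ σ a ≫ T.consFam σ f = T.consFam (τ ≫ σ) (T.famSub τ σ a f) := by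
  apply M.hom_ext
  · simp only [consFam, Category.assoc, M.cons_wk]
    rw [← Category.assoc, ← Category.assoc]
    exact congrArg (· ≫ σ) (M.lift_wk τ (M.tySub_lift_inst τ σ B a))
  · simp only [consFam, M.tmSub_comp, M.var_cons, famSub, sub]

theorem sup_tmSub {Δ : C} (σ : Δ ⟶ Γ) {A' : M.Ty Δ} {B' : M.Ty (M.ext Δ A')}
    (h : M.tySub σ A = A') (hB : M.tySub (M.lift σ h) B = B') (a : M.Term A)
    (f : M.Term (M.tySub (M.wk (M.tySub (M.inst a) B)) (T.W A B)))
    (hE : M.tySub σ (M.tySub (M.inst a) B) = M.tySub (M.inst (M.sub σ h a)) B')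
    (hW : M.tySub (M.lift σ hE) (M.tySub (M.wk (M.tySub (M.inst a) B)) (T.W A B)) =
      M.tySub (M.wk (M.tySub (M.inst (M.sub σ h a)) B')) (T.W A' B')) :
    M.tmSub σ (T.sup a f).1 = (T.sup (M.sub σ h a) (M.sub (M.lift σ hE) hW f)).1 := by
  subst h
  subst hB
  exact congrArg Subtype.val (T.sup_sub σ a f)

theorem comp_consTree_sup {Δ Θ : C} (τ : Θ ⟶ Δ) (σ : Δ ⟶ Γ) (a : M.Term (M.tySub σ A))
    (f : M.Term (M.tySub (M.wk (Arity B σ a)) (T.WAt B σ))) :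
    τ ≫ T.consTree σ (T.sup a f) =
      T.consTree (τ ≫ σ) (T.sup (labelSub τ σ a) (T.famSub τ σ a f)) := by
  apply M.hom_ext
  · simp only [consTree, Category.assoc, M.cons_wk]
  · rw [M.tmSub_comp, consTree, consTree, M.var_cons, M.var_cons]
    refine T.sup_tmSub τ _ ?_ a f (M.tySub_lift_inst τ σ B a) _
    rw [← M.tySub_comp]
    congr 1
    rw [lift, M.cons_lift]
    apply M.hom_ext
    · rw [M.cons_wk, M.lift_wk, Category.assoc]
    · rw [M.var_cons, lift, M.var_cons]

/-- The premise of the induction principle of `W A B` for a family `w : W A B ⊢ D w`: a term of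
`D (sup a f)` depending on `a : A`, on `x : B a ⊢ f x : W A B` and on `x : B a ⊢ h x : D (f x)`,
that is, such a term for all instances of `a`, `f`, `h` in contexts over `Γ`, compatibly with
substitution. -/
structure Step (D : M.Ty (M.ext Γ (T.W A B))) where
  step {Δ : C} (σ : Δ ⟶ Γ) (a : M.Term (M.tySub σ A))
    (f : M.Term (M.tySub (M.wk (Arity B σ a)) (T.WAt B σ)))
    (h : M.Term (M.tySub (T.consFam σ f) D)) :
    M.Term (M.tySub (T.consTree σ (T.sup a f)) D)
  step_sub {Δ Θ : C} (τ : Θ ⟶ Δ) (σ : Δ ⟶ Γ) (a : M.Term (M.tySub σ A))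
    (f : M.Term (M.tySub (M.wk (Arity B σ a)) (T.WAt B σ)))
    (h : M.Term (M.tySub (T.consFam σ f) D)) :
    M.sub τ (by rw [← M.tySub_comp, T.comp_consTree_sup]) (step σ a f h) =
      step (τ ≫ σ) (labelSub τ σ a) (T.famSub τ σ a f)
        (M.sub (arityLift B τ σ a) (by rw [← M.tySub_comp, T.comp_consFam]) h)

end WFormers

/-- `W`-types, with dependent elimination. As equality is extensional, the eliminator is uniquely
determined (and therefore stable under substitution). -/
structure WTypes extends M.WFormers where
  W_elim {Γ : C} {A : M.Ty Γ} {B : M.Ty (M.ext Γ A)} (D : M.Ty (M.ext Γ (W A B)))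
    (d : toWFormers.Step D) :
    ∃! r : M.Term D, ∀ {Δ : C} (σ : Δ ⟶ Γ) (a : M.Term (M.tySub σ A))
      (f : M.Term (M.tySub (M.wk (WFormers.Arity B σ a)) (toWFormers.WAt B σ))),
      M.sub (toWFormers.consTree σ (sup a f)) rfl r =
        d.step σ a f (M.sub (toWFormers.consFam σ f) rfl r)

/-- The type formers of extensional type theory: dependent products and sums, extensional equality,
the empty, unit and boolean types, and `W`-types. -/
structure ExtTT extends M.PiTypes, M.SigmaTypes, M.EqTypes, M.FiniteTypes, M.WTypes

/-- A sequence of universes à la Tarski: closed types `U i` (given in every context, stably under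
substitution) with families `El`. -/
structure Universes where
  U (i : ℕ) (Γ : C) : M.Ty Γ
  U_sub (i : ℕ) {Γ Δ : C} (σ : Δ ⟶ Γ) : M.tySub σ (U i Γ) = U i Δ
  El {i : ℕ} {Γ : C} (a : M.Term (U i Γ)) : M.Ty Γ
  El_sub {i : ℕ} {Γ Δ : C} (σ : Δ ⟶ Γ) (a : M.Term (U i Γ)) :
    M.tySub σ (El a) = El (M.sub σ (U_sub i σ) a)

namespace Universes

variable {M} (U : M.Universes)

/-- The codes `Γ ⊢ a : U i`. -/
abbrev Code (i : ℕ) (Γ : C) : Type w' := M.Term (U.U i Γ)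

/-- Substitution on codes. -/
abbrev codeSub {i : ℕ} {Γ Δ : C} (σ : Δ ⟶ Γ) (a : U.Code i Γ) : U.Code i Δ :=
  M.sub σ (U.U_sub i σ) a

/-- The substitution `σ.(El a)`. -/
abbrev liftEl {i : ℕ} {Γ Δ : C} (σ : Δ ⟶ Γ) (a : U.Code i Γ) :
    M.ext Δ (U.El (U.codeSub σ a)) ⟶ M.ext Γ (U.El a) :=
  M.lift σ (U.El_sub σ a)

/-- The universal code, in the context consisting of one variable of type `U i`. -/
def univCode (i : ℕ) : U.Code i (M.ext M.nil (U.U i M.nil)) :=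
  ⟨M.var (U.U i M.nil), (M.tp_var _).trans (U.U_sub i _)⟩

/-- The generic family `(A : U i, x : El A) ⟶ (A : U i)` of the `i`-th universe. -/
def genericFamily (i : ℕ) :
    M.ext (M.ext M.nil (U.U i M.nil)) (U.El (U.univCode i)) ⟶ M.ext M.nil (U.U i M.nil) :=
  M.wk (U.El (U.univCode i))

/-- The class of morphisms for which the `i`-th universe is generic: the pullbacks of its generic
family. -/
def classified (i : ℕ) : MorphismProperty C := fun X Y f =>
  ∃ (g : X ⟶ M.ext (M.ext M.nil (U.U i M.nil)) (U.El (U.univCode i)))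
    (c : Y ⟶ M.ext M.nil (U.U i M.nil)), IsPullback g f (U.genericFamily i) c

/-- The types which have, on the nose, a code in the `i`-th universe. -/
def IsSmall (i : ℕ) {Γ : C} (A : M.Ty Γ) : Prop := ∃ a : U.Code i Γ, U.El a = A

end Universes

/-- A strictly cumulative hierarchy of universes à la Tarski. Every universe has codes for all type
formers and for all earlier universes, which are stable under substitution and are decoded strictly
to the types they stand for. The coercions `cum` from lower to higher universes are functorial,
and commute strictly with substitution, with decoding and with all codes. -/
structure Hierarchy (T : M.ExtTT) extends M.Universes where
  cum {i j : ℕ} (h : i ≤ j) {Γ : C} (a : M.Term (U i Γ)) : M.Term (U j Γ)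
  cum_sub {i j : ℕ} (h : i ≤ j) {Γ Δ : C} (σ : Δ ⟶ Γ) (a : M.Term (U i Γ)) :
    toUniverses.codeSub σ (cum h a) = cum h (toUniverses.codeSub σ a)
  cum_refl {i : ℕ} {Γ : C} (a : M.Term (U i Γ)) : cum le_rfl a = a
  cum_trans {i j k : ℕ} (h : i ≤ j) (h' : j ≤ k) {Γ : C} (a : M.Term (U i Γ)) :
    cum h' (cum h a) = cum (h.trans h') a
  El_cum {i j : ℕ} (h : i ≤ j) {Γ : C} (a : M.Term (U i Γ)) : El a = El (cum h a)
  /-- the code of the universe `U i` in the universe `U j` -/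
  uni {i j : ℕ} (h : i < j) (Γ : C) : M.Term (U j Γ)
  uni_sub {i j : ℕ} (h : i < j) {Γ Δ : C} (σ : Δ ⟶ Γ) :
    toUniverses.codeSub σ (uni h Γ) = uni h Δ
  El_uni {i j : ℕ} (h : i < j) (Γ : C) : El (uni h Γ) = U i Γ
  cum_uni {i j k : ℕ} (h : i < j) (h' : j ≤ k) (Γ : C) :
    cum h' (uni h Γ) = uni (h.trans_le h') Γ
  /-- the code of a dependent product -/
  pi {i : ℕ} {Γ : C} (a : M.Term (U i Γ)) (b : M.Term (U i (M.ext Γ (El a)))) : M.Term (U i Γ)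
  pi_sub {i : ℕ} {Γ Δ : C} (σ : Δ ⟶ Γ) (a : M.Term (U i Γ))
    (b : M.Term (U i (M.ext Γ (El a)))) :
    toUniverses.codeSub σ (pi a b) =
      pi (toUniverses.codeSub σ a) (toUniverses.codeSub (toUniverses.liftEl σ a) b)
  El_pi {i : ℕ} {Γ : C} (a : M.Term (U i Γ)) (b : M.Term (U i (M.ext Γ (El a)))) :
    El (pi a b) = T.Pi (El a) (El b)
  cum_pi {i j : ℕ} (h : i ≤ j) {Γ : C} (a : M.Term (U i Γ))
    (b : M.Term (U i (M.ext Γ (El a)))) :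
    cum h (pi a b) = pi (cum h a) (cum h (toUniverses.codeSub (M.castCtx (El_cum h a)) b))
  /-- the code of a dependent sum -/
  sg {i : ℕ} {Γ : C} (a : M.Term (U i Γ)) (b : M.Term (U i (M.ext Γ (El a)))) : M.Term (U i Γ)
  sg_sub {i : ℕ} {Γ Δ : C} (σ : Δ ⟶ Γ) (a : M.Term (U i Γ))
    (b : M.Term (U i (M.ext Γ (El a)))) :
    toUniverses.codeSub σ (sg a b) =
      sg (toUniverses.codeSub σ a) (toUniverses.codeSub (toUniverses.liftEl σ a) b)
  El_sg {i : ℕ} {Γ : C} (a : M.Term (U i Γ)) (b : M.Term (U i (M.ext Γ (El a)))) :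
    El (sg a b) = T.Sig (El a) (El b)
  cum_sg {i j : ℕ} (h : i ≤ j) {Γ : C} (a : M.Term (U i Γ))
    (b : M.Term (U i (M.ext Γ (El a)))) :
    cum h (sg a b) = sg (cum h a) (cum h (toUniverses.codeSub (M.castCtx (El_cum h a)) b))
  /-- the code of a `W`-type -/
  wt {i : ℕ} {Γ : C} (a : M.Term (U i Γ)) (b : M.Term (U i (M.ext Γ (El a)))) : M.Term (U i Γ)
  wt_sub {i : ℕ} {Γ Δ : C} (σ : Δ ⟶ Γ) (a : M.Term (U i Γ))
    (b : M.Term (U i (M.ext Γ (El a)))) :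
    toUniverses.codeSub σ (wt a b) =
      wt (toUniverses.codeSub σ a) (toUniverses.codeSub (toUniverses.liftEl σ a) b)
  El_wt {i : ℕ} {Γ : C} (a : M.Term (U i Γ)) (b : M.Term (U i (M.ext Γ (El a)))) :
    El (wt a b) = T.W (El a) (El b)
  cum_wt {i j : ℕ} (h : i ≤ j) {Γ : C} (a : M.Term (U i Γ))
    (b : M.Term (U i (M.ext Γ (El a)))) :
    cum h (wt a b) = wt (cum h a) (cum h (toUniverses.codeSub (M.castCtx (El_cum h a)) b))
  /-- the code of an equality type -/
  eq {i : ℕ} {Γ : C} (a : M.Term (U i Γ)) (s t : M.Term (El a)) : M.Term (U i Γ)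
  eq_sub {i : ℕ} {Γ Δ : C} (σ : Δ ⟶ Γ) (a : M.Term (U i Γ)) (s t : M.Term (El a)) :
    toUniverses.codeSub σ (eq a s t) =
      eq (toUniverses.codeSub σ a) (M.sub σ (El_sub σ a) s) (M.sub σ (El_sub σ a) t)
  El_eq {i : ℕ} {Γ : C} (a : M.Term (U i Γ)) (s t : M.Term (El a)) :
    El (eq a s t) = T.EqTy s t
  cum_eq {i j : ℕ} (h : i ≤ j) {Γ : C} (a : M.Term (U i Γ)) (s t : M.Term (El a)) :
    cum h (eq a s t) = eq (cum h a) (M.castTm (El_cum h a) s) (M.castTm (El_cum h a) t)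
  /-- the code of the empty type -/
  zero (i : ℕ) (Γ : C) : M.Term (U i Γ)
  zero_sub (i : ℕ) {Γ Δ : C} (σ : Δ ⟶ Γ) : toUniverses.codeSub σ (zero i Γ) = zero i Δ
  El_zero (i : ℕ) (Γ : C) : El (zero i Γ) = T.Zero Γ
  cum_zero {i j : ℕ} (h : i ≤ j) (Γ : C) : cum h (zero i Γ) = zero j Γ
  /-- the code of the unit type -/
  one (i : ℕ) (Γ : C) : M.Term (U i Γ)
  one_sub (i : ℕ) {Γ Δ : C} (σ : Δ ⟶ Γ) : toUniverses.codeSub σ (one i Γ) = one i Δ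
  El_one (i : ℕ) (Γ : C) : El (one i Γ) = T.One Γ
  cum_one {i j : ℕ} (h : i ≤ j) (Γ : C) : cum h (one i Γ) = one j Γ
  /-- the code of the type of booleans -/
  two (i : ℕ) (Γ : C) : M.Term (U i Γ)
  two_sub (i : ℕ) {Γ Δ : C} (σ : Δ ⟶ Γ) : toUniverses.codeSub σ (two i Γ) = two i Δ
  El_two (i : ℕ) (Γ : C) : El (two i Γ) = T.Two Γ
  cum_two {i j : ℕ} (h : i ≤ j) (Γ : C) : cum h (two i Γ) = two j Γ

namespace Hierarchy

variable {M} {T : M.ExtTT}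

/-- The codes of the hierarchy are injective: in every context, a code of a dependent product, of a
dependent sum, of a `W`-type or of an equality type determines the arguments it is formed from.
(As equality is extensional, this is injectivity in the internal sense.) -/
structure InjectiveCodes (V : M.Hierarchy T) : Prop where
  pi_injective (i : ℕ) (Γ : C) : Function.Injective
    (fun x : (Σ a : V.Code i Γ, V.Code i (M.ext Γ (V.El a))) => V.pi x.1 x.2)
  sg_injective (i : ℕ) (Γ : C) : Function.Injective
    (fun x : (Σ a : V.Code i Γ, V.Code i (M.ext Γ (V.El a))) => V.sg x.1 x.2)
  wt_injective (i : ℕ) (Γ : C) : Function.Injective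
    (fun x : (Σ a : V.Code i Γ, V.Code i (M.ext Γ (V.El a))) => V.wt x.1 x.2)
  eq_injective (i : ℕ) (Γ : C) : Function.Injective
    (fun x : (Σ a : V.Code i Γ, M.Term (V.El a) × M.Term (V.El a)) => V.eq x.1 x.2.1 x.2.2)

/-- `V` replaces `U`: there are functions `up : U i → V i` and `dec : V i → U i` (natural in the
context) with `dec ∘ up = id`, such that `V i` is decoded through `dec`, both functions commute with
the coercions, and `dec` sends the codes of the type formers in `V` to those in `U`. -/
structure Replacement (U V : M.Hierarchy T) where
  up {i : ℕ} {Γ : C} (a : U.Code i Γ) : V.Code i Γ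
  up_sub {i : ℕ} {Γ Δ : C} (σ : Δ ⟶ Γ) (a : U.Code i Γ) :
    V.codeSub σ (up a) = up (U.codeSub σ a)
  dec {i : ℕ} {Γ : C} (a : V.Code i Γ) : U.Code i Γ
  dec_sub {i : ℕ} {Γ Δ : C} (σ : Δ ⟶ Γ) (a : V.Code i Γ) :
    U.codeSub σ (dec a) = dec (V.codeSub σ a)
  dec_up {i : ℕ} {Γ : C} (a : U.Code i Γ) : dec (up a) = a
  El_dec {i : ℕ} {Γ : C} (a : V.Code i Γ) : V.El a = U.El (dec a)
  cum_up {i j : ℕ} (h : i ≤ j) {Γ : C} (a : U.Code i Γ) : V.cum h (up a) = up (U.cum h a)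
  dec_cum {i j : ℕ} (h : i ≤ j) {Γ : C} (a : V.Code i Γ) : dec (V.cum h a) = U.cum h (dec a)
  dec_pi {i : ℕ} {Γ : C} (a : V.Code i Γ) (b : V.Code i (M.ext Γ (V.El a))) :
    dec (V.pi a b) = U.pi (dec a) (U.codeSub (M.castCtx (El_dec a)) (dec b))
  dec_sg {i : ℕ} {Γ : C} (a : V.Code i Γ) (b : V.Code i (M.ext Γ (V.El a))) :
    dec (V.sg a b) = U.sg (dec a) (U.codeSub (M.castCtx (El_dec a)) (dec b))
  dec_wt {i : ℕ} {Γ : C} (a : V.Code i Γ) (b : V.Code i (M.ext Γ (V.El a))) :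
    dec (V.wt a b) = U.wt (dec a) (U.codeSub (M.castCtx (El_dec a)) (dec b))
  dec_eq {i : ℕ} {Γ : C} (a : V.Code i Γ) (s t : M.Term (V.El a)) :
    dec (V.eq a s t) = U.eq (dec a) (M.castTm (El_dec a) s) (M.castTm (El_dec a) t)
  dec_zero (i : ℕ) (Γ : C) : dec (V.zero i Γ) = U.zero i Γ
  dec_one (i : ℕ) (Γ : C) : dec (V.one i Γ) = U.one i Γ
  dec_two (i : ℕ) (Γ : C) : dec (V.two i Γ) = U.two i Γ

end Hierarchy

end NatModel

/-!
Let the tags at level `i` be the well-founded trees whose nodes are labelled by codes `n : U i` and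
branch over `El n`, as in Aczel's type of iterative sets. A code of `V i` is a code of `U i`
together with a tag. Decoding looks at the code only, so the codes of `V i` stand for the same types
as those of `U i`, and forgetting the tag is the function `Dec`. The tag is free to record the
arguments from which a compound code has been formed; since the tree constructor is injective, so
are the operations forming compound codes. The remaining codes, and the values of `Up`, are tagged
with the tree without subtrees. Finally, the level above has a code for the type of pairs of a code
and a tag, as it has codes for `U i`, for `W`-types and for dependent sums.
-/

namespace NatModel

variable {C : Type u} [Category.{v} C] {M : NatModel.{u, v, w, w'} C}

theorem sub_sub {Γ Δ Θ : C} (τ : Θ ⟶ Δ) (σ : Δ ⟶ Γ) {A : M.Ty Γ} {A' : M.Ty Δ} {A'' : M.Ty Θ}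
    (h : M.tySub σ A = A') (h' : M.tySub τ A' = A'') (t : M.Term A) :
    M.sub τ h' (M.sub σ h t) = M.sub (τ ≫ σ) (by rw [M.tySub_comp, h, h']) t :=
  Subtype.ext (M.tmSub_comp τ σ t.1).symm

theorem lift_id {Γ : C} {A : M.Ty Γ} (h : M.tySub (𝟙 Γ) A = A) :
    M.lift (𝟙 Γ) h = 𝟙 (M.ext Γ A) := by
  apply M.hom_ext
  · rw [M.lift_wk, Category.comp_id, Category.id_comp]
  · rw [lift, M.var_cons, M.tmSub_id]

theorem castCtx_rfl {Γ : C} {A : M.Ty Γ} (h : A = A) : M.castCtx h = 𝟙 (M.ext Γ A) :=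
  lift_id _

theorem castCtx_comp_lift {Γ Δ : C} (σ : Δ ⟶ Γ) {A : M.Ty Γ} {A' A'' : M.Ty Δ}
    (h : M.tySub σ A = A') (h' : A' = A'') :
    M.castCtx h' ≫ M.lift σ h = M.lift σ (h.trans h') := by
  subst h'
  rw [castCtx_rfl, Category.id_comp]

theorem lift_comp_castCtx {Γ Δ : C} (σ : Δ ⟶ Γ) {A A' : M.Ty Γ} {A'' : M.Ty Δ}
    (h : A = A') (h' : M.tySub σ A' = A'') :
    M.lift σ h' ≫ M.castCtx h = M.lift σ (by rw [h, h']) := by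
  subst h
  rw [castCtx_rfl, Category.comp_id]

theorem tmSub_lift_var {Γ Δ : C} (σ : Δ ⟶ Γ) {A : M.Ty Γ} {A' : M.Ty Δ} (h : M.tySub σ A = A') :
    M.tmSub (M.lift σ h) (M.var A) = M.var A' :=
  M.var_cons _ _ _ _

theorem inst_wk {Γ : C} {A : M.Ty Γ} (a : M.Term A) : M.inst a ≫ M.wk A = 𝟙 Γ :=
  M.cons_wk _ _ _ _

theorem tmSub_inst_var {Γ : C} {A : M.Ty Γ} (a : M.Term A) : M.tmSub (M.inst a) (M.var A) = a.1 :=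
  M.var_cons _ _ _ _

theorem sub_lift_sub_wk {Γ Δ : C} (σ : Δ ⟶ Γ) {A B : M.Ty Γ} {A' B' : M.Ty Δ}
    {E : M.Ty (M.ext Γ A)} {E' : M.Ty (M.ext Δ A')} (h : M.tySub σ A = A')
    (hE : M.tySub (M.wk A) B = E) (hE' : M.tySub (M.lift σ h) E = E') (hB : M.tySub σ B = B')
    (hB' : M.tySub (M.wk A') B' = E') (t : M.Term B) :
    M.sub (M.lift σ h) hE' (M.sub (M.wk A) hE t) = M.sub (M.wk A') hB' (M.sub σ hB t) :=
  Subtype.ext (by simp only [NatModel.sub, ← M.tmSub_comp, M.lift_wk])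

theorem sub_inst_sub_wk {Γ : C} {A B : M.Ty Γ} {E : M.Ty (M.ext Γ A)} (s : M.Term A)
    (hE : M.tySub (M.wk A) B = E) (hB : M.tySub (M.inst s) E = B) (t : M.Term B) :
    M.sub (M.inst s) hB (M.sub (M.wk A) hE t) = t :=
  Subtype.ext (by simp only [NatModel.sub, ← M.tmSub_comp, inst_wk, M.tmSub_id])

theorem isPullback_lift {Γ Δ : C} (σ : Δ ⟶ Γ) {A : M.Ty Γ} {A' : M.Ty Δ}
    (h : M.tySub σ A = A') : IsPullback (M.lift σ h) (M.wk A') (M.wk A) σ := by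
  have tp_fst (s : Limits.PullbackCone (M.wk A) σ) :
      M.tp (M.tmSub s.fst (M.var A)) = M.tySub s.snd A' := by
    rw [M.tp_tmSub, M.tp_var, ← M.tySub_comp, s.condition, M.tySub_comp, h]
  refine ⟨⟨M.lift_wk σ h⟩, ⟨Limits.PullbackCone.IsLimit.mk _
    (fun s => M.cons s.snd A' (M.tmSub s.fst (M.var A)) (tp_fst s)) (fun s => ?_)
    (fun s => M.cons_wk _ _ _ _) (fun s m hfst hsnd => ?_)⟩⟩
  · rw [M.cons_lift]
    apply M.hom_ext
    · rw [M.cons_wk, s.condition]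
    · rw [M.var_cons]
  · apply M.hom_ext
    · rw [M.cons_wk, hsnd]
    · rw [M.var_cons, ← hfst, M.tmSub_comp, tmSub_lift_var]

theorem PiTypes.Pi_tySub (P : M.PiTypes) {Γ Δ : C} (σ : Δ ⟶ Γ) {A : M.Ty Γ} {B : M.Ty (M.ext Γ A)}
    {A' : M.Ty Δ} {B' : M.Ty (M.ext Δ A')} (h : M.tySub σ A = A')
    (hB : M.tySub (M.lift σ h) B = B') : M.tySub σ (P.Pi A B) = P.Pi A' B' := by
  subst h hB
  exact P.Pi_sub σ A B

theorem PiTypes.lam_tmSub (P : M.PiTypes) {Γ Δ : C} (σ : Δ ⟶ Γ) {A : M.Ty Γ}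
    {B : M.Ty (M.ext Γ A)} {A' : M.Ty Δ} {B' : M.Ty (M.ext Δ A')} (h : M.tySub σ A = A')
    (hB : M.tySub (M.lift σ h) B = B') (b : M.Term B) :
    M.tmSub σ (P.lam b).1 = (P.lam (M.sub (M.lift σ h) hB b)).1 := by
  subst h hB
  exact congrArg Subtype.val (P.lam_sub σ b)

theorem SigmaTypes.Sig_tySub (S : M.SigmaTypes) {Γ Δ : C} (σ : Δ ⟶ Γ) {A : M.Ty Γ}
    {B : M.Ty (M.ext Γ A)} {A' : M.Ty Δ} {B' : M.Ty (M.ext Δ A')} (h : M.tySub σ A = A')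
    (hB : M.tySub (M.lift σ h) B = B') : M.tySub σ (S.Sig A B) = S.Sig A' B' := by
  subst h hB
  exact S.Sig_sub σ A B

theorem SigmaTypes.pair_tmSub (S : M.SigmaTypes) {Γ Δ : C} (σ : Δ ⟶ Γ) {A : M.Ty Γ}
    {B : M.Ty (M.ext Γ A)} {A' : M.Ty Δ} {B' : M.Ty (M.ext Δ A')} (h : M.tySub σ A = A')
    (hB : M.tySub (M.lift σ h) B = B') (a : M.Term A) (b : M.Term (M.tySub (M.inst a) B))
    (hb : M.tySub σ (M.tySub (M.inst a) B) = M.tySub (M.inst (M.sub σ h a)) B') :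
    M.tmSub σ (S.pair a b).1 = (S.pair (M.sub σ h a) (M.sub σ hb b)).1 := by
  subst h hB
  exact congrArg Subtype.val (S.pair_sub σ a b)

theorem WFormers.W_tySub (T : M.WFormers) {Γ Δ : C} (σ : Δ ⟶ Γ) {A : M.Ty Γ}
    {B : M.Ty (M.ext Γ A)} {A' : M.Ty Δ} {B' : M.Ty (M.ext Δ A')} (h : M.tySub σ A = A')
    (hB : M.tySub (M.lift σ h) B = B') : M.tySub σ (T.W A B) = T.W A' B' := by
  subst h hB
  exact T.W_sub σ A B

/-- A closed type, encoded as a type in every context that is stable under substitution, like the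
universes `U i`. -/
structure ClosedTy (M : NatModel.{u, v, w, w'} C) where
  ty (Γ : C) : M.Ty Γ
  ty_sub {Γ Δ : C} (σ : Δ ⟶ Γ) : M.tySub σ (ty Γ) = ty Δ

namespace ClosedTy

variable (X : M.ClosedTy)

/-- The terms of a closed type in a given context. -/
abbrev Tm (Γ : C) : Type w' := M.Term (X.ty Γ)

/-- Substitution in the terms of a closed type. -/
abbrev sub {Γ Δ : C} (σ : Δ ⟶ Γ) (t : X.Tm Γ) : X.Tm Δ := M.sub σ (X.ty_sub σ) t

theorem sub_sub {Γ Δ Θ : C} (τ : Θ ⟶ Δ) (σ : Δ ⟶ Γ) (t : X.Tm Γ) :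
    X.sub τ (X.sub σ t) = X.sub (τ ≫ σ) t :=
  NatModel.sub_sub τ σ _ _ t

theorem sub_castCtx_rfl {Γ : C} {A : M.Ty Γ} (h : A = A) (t : X.Tm (M.ext Γ A)) :
    X.sub (M.castCtx h) t = t :=
  Subtype.ext ((congrArg (M.tmSub · t.1) (castCtx_rfl h)).trans (M.tmSub_id t.1))

/-- The last variable of a context extended by a closed type. -/
def var (Γ : C) : X.Tm (M.ext Γ (X.ty Γ)) :=
  ⟨M.var (X.ty Γ), (M.tp_var _).trans (X.ty_sub _)⟩

theorem sub_lift_var {Γ Δ : C} (σ : Δ ⟶ Γ) :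
    X.sub (M.lift σ (X.ty_sub σ)) (X.var Γ) = X.var Δ :=
  Subtype.ext (tmSub_lift_var σ _)

/-- The classifying substitution of a term of a closed type `X`: its target is the context of one
variable of type `X`. -/
def point {Γ : C} (t : X.Tm Γ) : Γ ⟶ M.ext M.nil (X.ty M.nil) :=
  M.cons (M.nilTerminal.from Γ) (X.ty M.nil) t.1 (t.2.trans (X.ty_sub _).symm)

theorem sub_point_var {Γ : C} (t : X.Tm Γ) : X.sub (X.point t) (X.var M.nil) = t :=
  Subtype.ext (M.var_cons _ _ _ _)

theorem eq_point {Γ : C} {σ : Γ ⟶ M.ext M.nil (X.ty M.nil)} {t : X.Tm Γ}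
    (h : M.tmSub σ (M.var (X.ty M.nil)) = t.1) : σ = X.point t :=
  M.hom_ext (M.nilTerminal.hom_ext _ _) (h.trans (M.var_cons _ _ _ _).symm)

theorem comp_point {Γ Δ : C} (σ : Δ ⟶ Γ) (t : X.Tm Γ) :
    σ ≫ X.point t = X.point (X.sub σ t) :=
  X.eq_point (by rw [M.tmSub_comp, point, M.var_cons]; rfl)

section Product

variable (S : M.SigmaTypes) (Y : M.ClosedTy)

/-- The product of two closed types, as a non-dependent sum. -/
def prod : M.ClosedTy where
  ty Γ := S.Sig (X.ty Γ) (Y.ty _)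
  ty_sub σ := S.Sig_tySub σ (X.ty_sub σ) (Y.ty_sub _)

variable {X Y}

/-- Pairing in a product of closed types. -/
def pair {Γ : C} (x : X.Tm Γ) (y : Y.Tm Γ) : (prod X S Y).Tm Γ :=
  S.pair x (M.castTm (Y.ty_sub _).symm y)

theorem sub_pair {Γ Δ : C} (σ : Δ ⟶ Γ) (x : X.Tm Γ) (y : Y.Tm Γ) :
    (prod X S Y).sub σ (pair S x y) = pair S (X.sub σ x) (Y.sub σ y) :=
  Subtype.ext (S.pair_tmSub σ (X.ty_sub σ) (Y.ty_sub _) x (M.castTm (Y.ty_sub _).symm y)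
    (by rw [Y.ty_sub, Y.ty_sub, Y.ty_sub]))

theorem pair_bijective (Γ : C) : Function.Bijective
    (fun q : X.Tm Γ × Y.Tm Γ => (pair S q.1 q.2 : (prod X S Y).Tm Γ)) := by
  refine ⟨fun ⟨x, y⟩ ⟨x', y'⟩ h => ?_, fun p => ?_⟩
  · obtain ⟨rfl, hy⟩ := Sigma.mk.inj ((S.pair_bijective (X.ty Γ) (Y.ty _)).1
      (a₁ := ⟨x, M.castTm (Y.ty_sub _).symm y⟩) (a₂ := ⟨x', M.castTm (Y.ty_sub _).symm y'⟩) h)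
    exact congrArg (Prod.mk x) (Subtype.ext (congrArg Subtype.val (eq_of_heq hy) :))
  · obtain ⟨⟨x, y⟩, h⟩ := (S.pair_bijective (X.ty Γ) (Y.ty _)).2 p
    exact ⟨⟨x, M.castTm (Y.ty_sub _) y⟩, h⟩

/-- The universal property of the product: its terms are the pairs of terms. -/
noncomputable def pairEquiv (Γ : C) : X.Tm Γ × Y.Tm Γ ≃ (prod X S Y).Tm Γ :=
  Equiv.ofBijective _ (pair_bijective S Γ)

variable {S}

/-- The first projection of a product of closed types. -/
noncomputable def fst {Γ : C} (p : (prod X S Y).Tm Γ) : X.Tm Γ := ((pairEquiv S Γ).symm p).1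

/-- The second projection of a product of closed types. -/
noncomputable def snd {Γ : C} (p : (prod X S Y).Tm Γ) : Y.Tm Γ := ((pairEquiv S Γ).symm p).2

theorem pair_fst_snd {Γ : C} (p : (prod X S Y).Tm Γ) : pair S (fst p) (snd p) = p :=
  (pairEquiv S Γ).apply_symm_apply p

theorem fst_pair {Γ : C} (x : X.Tm Γ) (y : Y.Tm Γ) : fst (pair S x y) = x :=
  congrArg Prod.fst ((pairEquiv S Γ).symm_apply_apply (x, y))

theorem snd_pair {Γ : C} (x : X.Tm Γ) (y : Y.Tm Γ) : snd (pair S x y) = y :=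
  congrArg Prod.snd ((pairEquiv S Γ).symm_apply_apply (x, y))

theorem sub_fst {Γ Δ : C} (σ : Δ ⟶ Γ) (p : (prod X S Y).Tm Γ) :
    X.sub σ (fst p) = fst ((prod X S Y).sub σ p) := by
  rw [← pair_fst_snd p, sub_pair, fst_pair, fst_pair]

theorem sub_snd {Γ Δ : C} (σ : Δ ⟶ Γ) (p : (prod X S Y).Tm Γ) :
    Y.sub σ (snd p) = snd ((prod X S Y).sub σ p) := by
  rw [← pair_fst_snd p, sub_pair, snd_pair, snd_pair]

end Product

end ClosedTy

/-- A family of types over a closed type, stable under substitution, like the decoding of the codes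
of a universe. -/
structure ClosedFam (X : M.ClosedTy) where
  fam {Γ : C} (a : X.Tm Γ) : M.Ty Γ
  fam_sub {Γ Δ : C} (σ : Δ ⟶ Γ) (a : X.Tm Γ) : M.tySub σ (fam a) = fam (X.sub σ a)

namespace ClosedFam

variable {X Y : M.ClosedTy}

section

variable (B : ClosedFam X)

theorem fam_sub_of_eq {Γ Δ : C} (σ : Δ ⟶ Γ) {a : X.Tm Γ} {A : M.Ty Γ} {A' : M.Ty Δ}
    (hA : B.fam a = A) (hσ : M.tySub σ A = A') : B.fam (X.sub σ a) = A' := by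
  rw [← B.fam_sub, hA, hσ]

/-- The family `B` as a type in the context extended by a variable of the closed type. -/
abbrev openTy (Γ : C) : M.Ty (M.ext Γ (X.ty Γ)) := B.fam (X.var Γ)

theorem tySub_openTy {Γ Δ : C} (σ : Δ ⟶ M.ext Γ (X.ty Γ)) (a : X.Tm Δ)
    (h : M.tmSub σ (M.var (X.ty Γ)) = a.1) : M.tySub σ (B.openTy Γ) = B.fam a := by
  rw [B.fam_sub]
  exact congrArg B.fam (Subtype.ext h)

theorem openTy_inst {Γ : C} (a : X.Tm Γ) : M.tySub (M.inst a) (B.openTy Γ) = B.fam a :=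
  B.tySub_openTy _ _ (tmSub_inst_var a)

theorem openTy_lift {Γ Δ : C} (σ : Δ ⟶ Γ) :
    M.tySub (M.lift σ (X.ty_sub σ)) (B.openTy Γ) = B.openTy Δ :=
  B.tySub_openTy _ _ (tmSub_lift_var σ _)

theorem openTy_point {Γ : C} (a : X.Tm Γ) : M.tySub (X.point a) (B.openTy M.nil) = B.fam a :=
  B.tySub_openTy _ _ (M.var_cons _ _ _ _)

/-- A section of a family: a term of each of its types, stable under substitution. -/
@[ext]
structure Section where
  app {Γ : C} (a : X.Tm Γ) : M.Term (B.fam a)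
  app_sub {Γ Δ : C} (σ : Δ ⟶ Γ) (a : X.Tm Γ) :
    M.sub σ (B.fam_sub σ a) (app a) = app (X.sub σ a)

variable {B}

theorem Section.val_congr (s : B.Section) {Γ : C} {a a' : X.Tm Γ} (h : a = a') :
    (s.app a).1 = (s.app a').1 := by
  rw [h]

theorem Section.tmSub_app (s : B.Section) {Γ Δ : C} (σ : Δ ⟶ Γ) (a : X.Tm Γ) :
    M.tmSub σ (s.app a).1 = (s.app (X.sub σ a)).1 :=
  congrArg Subtype.val (s.app_sub σ a)

variable (B)

/-- A section is determined by its value at the generic term, the variable of type `X`. -/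
def sectionEquiv : M.Term (B.openTy M.nil) ≃ B.Section where
  toFun r :=
    { app a := M.sub (X.point a) (B.openTy_point a) r
      app_sub σ a := Subtype.ext (by
        simp only [NatModel.sub, ← M.tmSub_comp, X.comp_point]) }
  invFun s := s.app (X.var M.nil)
  left_inv r := Subtype.ext
    ((congrArg (M.tmSub · r.1) (X.eq_point (M.tmSub_id _)).symm).trans (M.tmSub_id r.1))
  right_inv s := by
    ext Γ a : 3
    exact Subtype.ext ((s.tmSub_app _ _).trans (s.val_congr (X.sub_point_var a)))

end

/-- The family over `X` whose types are all the closed type `Y`; its sections are the functions from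
`X` to `Y`. -/
abbrev const (X Y : M.ClosedTy) : ClosedFam X where
  fam {Γ} _ := Y.ty Γ
  fam_sub σ _ := Y.ty_sub σ

theorem Section.sub_app (G : (const X Y).Section) {Γ Δ : C} (σ : Δ ⟶ Γ) (a : X.Tm Γ) :
    Y.sub σ (G.app a) = G.app (X.sub σ a) :=
  G.app_sub σ a

variable {L : M.ClosedTy} (B : ClosedFam L) (T : M.WFormers)

/-- The closed type of well-founded trees with labels in the closed type `L`, whose nodes labelled
`a` branch over `B.fam a`. -/
def wTy : M.ClosedTy where
  ty Γ := T.W (L.ty Γ) (B.openTy Γ)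
  ty_sub σ := T.W_tySub σ (L.ty_sub σ) (B.openTy_lift σ)

/-- The tree with root label `a` and family of subtrees `f`. The family may be indexed by any type
equal to `B.fam a`, so that it need not be transported along such equalities. -/
def sup {Γ : C} {A : M.Ty Γ} (a : L.Tm Γ) (hA : B.fam a = A) (f : (B.wTy T).Tm (M.ext Γ A)) :
    (B.wTy T).Tm Γ :=
  T.sup a (M.sub (M.castCtx ((B.openTy_inst a).trans hA).symm)
    (((B.wTy T).ty_sub _).trans ((B.wTy T).ty_sub _).symm) f)

variable {T}

theorem sub_sup {Γ Δ : C} (σ : Δ ⟶ Γ) {A : M.Ty Γ} {A' : M.Ty Δ} (hσ : M.tySub σ A = A')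
    (a : L.Tm Γ) (hA : B.fam a = A) (f : (B.wTy T).Tm (M.ext Γ A)) :
    (B.wTy T).sub σ (B.sup T a hA f) =
      B.sup T (L.sub σ a) (B.fam_sub_of_eq σ hA hσ) ((B.wTy T).sub (M.lift σ hσ) f) := by
  have hE : M.tySub σ (M.tySub (M.inst a) (B.openTy Γ)) =
      M.tySub (M.inst (L.sub σ a)) (B.openTy Δ) := by
    rw [B.openTy_inst, B.openTy_inst, B.fam_sub]
  have hW : M.tySub (M.lift σ hE) (M.tySub (M.wk _) ((B.wTy T).ty Γ)) =
      M.tySub (M.wk _) ((B.wTy T).ty Δ) := by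
    rw [(B.wTy T).ty_sub, (B.wTy T).ty_sub, (B.wTy T).ty_sub]
  refine Subtype.ext ((T.sup_tmSub σ (L.ty_sub σ) (B.openTy_lift σ) a _ hE hW).trans ?_)
  exact congrArg (fun g => (T.sup (L.sub σ a) g).1) (Subtype.ext (by
    simp only [NatModel.sub, ← M.tmSub_comp, castCtx_comp_lift]
    exact congrArg (M.tmSub · f.1) (lift_comp_castCtx σ _ hE)))

theorem sup_congr {Γ : C} {A : M.Ty Γ} {a a' : L.Tm Γ} (ha : a = a') (hA : B.fam a = A)
    {f f' : (B.wTy T).Tm (M.ext Γ A)} (hf : f = f') :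
    B.sup T a hA f = B.sup T a' (ha ▸ hA) f' := by
  subst ha hf
  rfl

theorem sup_castCtx {Γ : C} {A A' : M.Ty Γ} (h : A = A') (a : L.Tm Γ) (hA : B.fam a = A)
    (f : (B.wTy T).Tm (M.ext Γ A)) :
    B.sup T a (hA.trans h) ((B.wTy T).sub (M.castCtx h) f) = B.sup T a hA f := by
  subst h
  rw [ClosedTy.sub_castCtx_rfl]

section Elimination

theorem arity_eq {Γ : C} (σ : Γ ⟶ M.nil) (a : M.Term (M.tySub σ (L.ty M.nil))) :
    B.fam (M.castTm (L.ty_sub σ) a) = WFormers.Arity (B.openTy M.nil) σ a := by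
  rw [WFormers.Arity, ← M.tySub_comp]
  refine (B.tySub_openTy _ _ ?_).symm
  rw [M.tmSub_comp, tmSub_lift_var, tmSub_inst_var]
  rfl

theorem tySub_wk_wAt {Γ : C} (σ : Γ ⟶ M.nil) (E : M.Ty Γ) :
    M.tySub (M.wk E) (T.WAt (B.openTy M.nil) σ) = (B.wTy T).ty (M.ext Γ E) := by
  rw [WFormers.WAt, ← T.W_sub]
  exact (congrArg (M.tySub (M.wk E)) ((B.wTy T).ty_sub σ)).trans ((B.wTy T).ty_sub _)

theorem val_sup {Γ : C} {A : M.Ty Γ} {B' : M.Ty (M.ext Γ A)} (h : A = L.ty Γ)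
    (hB : M.tySub (M.castCtx h) B' = B.openTy Γ) (a : M.Term A)
    (f : M.Term (M.tySub (M.wk (M.tySub (M.inst a) B')) (T.W A B')))
    (ha : B.fam (M.castTm h a) = M.tySub (M.inst a) B')
    (hf : M.tySub (M.wk (M.tySub (M.inst a) B')) (T.W A B') = (B.wTy T).ty _) :
    (T.sup a f).1 = (B.sup T (M.castTm h a) ha (M.castTm hf f)).1 := by
  subst h
  rw [castCtx_rfl, M.tySub_id] at hB
  subst hB
  exact congrArg (fun g => (T.sup a g).1)
    (Subtype.ext (congrArg Subtype.val ((B.wTy T).sub_castCtx_rfl rfl (M.castTm hf f))).symm)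

theorem consTree_sup {Γ : C} (σ : Γ ⟶ M.nil) (a : M.Term (M.tySub σ (L.ty M.nil)))
    (f : M.Term (M.tySub (M.wk (WFormers.Arity (B.openTy M.nil) σ a))
      (T.WAt (B.openTy M.nil) σ))) :
    T.consTree σ (T.sup a f) = (B.wTy T).point (B.sup T (M.castTm (L.ty_sub σ) a)
      (B.arity_eq σ a) (M.castTm (B.tySub_wk_wAt σ _) f)) := by
  refine (B.wTy T).eq_point ((M.var_cons _ _ _ _).trans (B.val_sup (L.ty_sub σ) ?_ a f _ _))
  rw [← M.tySub_comp]
  exact B.tySub_openTy _ _ (by rw [castCtx_comp_lift, tmSub_lift_var]; rfl)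

theorem consFam_eq_point {Γ : C} (σ : Γ ⟶ M.nil) {E : M.Ty Γ}
    (f : M.Term (M.tySub (M.wk E) (T.WAt (B.openTy M.nil) σ))) :
    T.consFam σ f = (B.wTy T).point (M.castTm (B.tySub_wk_wAt σ E) f) :=
  (B.wTy T).eq_point (M.var_cons _ _ _ _)

variable (T) in
/-- The premise of the elimination of the trees of `B.wTy T` into the family `D`: a term over
`B.sup T a hA f` for every term over `f`, in every context and stably under substitution. -/
structure Step (D : ClosedFam (B.wTy T)) where
  step {Γ : C} {A : M.Ty Γ} (a : L.Tm Γ) (hA : B.fam a = A) (f : (B.wTy T).Tm (M.ext Γ A))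
    (r : M.Term (D.fam f)) : M.Term (D.fam (B.sup T a hA f))
  step_sub {Γ Δ : C} (σ : Δ ⟶ Γ) {A : M.Ty Γ} {A' : M.Ty Δ} (hσ : M.tySub σ A = A')
    (a : L.Tm Γ) (hA : B.fam a = A) (f : (B.wTy T).Tm (M.ext Γ A)) (r : M.Term (D.fam f)) :
    M.tmSub σ (step a hA f r).1 =
      (step (L.sub σ a) (B.fam_sub_of_eq σ hA hσ) ((B.wTy T).sub (M.lift σ hσ) f)
        (M.sub (M.lift σ hσ) (D.fam_sub _ _) r)).1

namespace Step

variable {B} {D : ClosedFam (B.wTy T)} (d : B.Step T D)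

theorem val_congr {Γ : C} {A : M.Ty Γ} {a a' : L.Tm Γ} (ha : a = a') {hA : B.fam a = A}
    {f f' : (B.wTy T).Tm (M.ext Γ A)} (hf : f = f') {r : M.Term (D.fam f)}
    {r' : M.Term (D.fam f')} (hr : r.1 = r'.1) :
    (d.step a hA f r).1 = (d.step a' (ha ▸ hA) f' r').1 := by
  subst ha hf
  rw [Subtype.ext hr]

/-- The premise of `W_elim` for the open type of `D`. -/
def toStep : T.Step (D.openTy M.nil) where
  step σ a f r := M.castTm
    ((congrArg (M.tySub · _) (B.consTree_sup σ a f)).trans (D.openTy_point _)).symm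
    (d.step (M.castTm (L.ty_sub σ) a) (B.arity_eq σ a) (M.castTm (B.tySub_wk_wAt σ _) f)
      (M.castTm ((congrArg (M.tySub · _) (B.consFam_eq_point σ f)).trans (D.openTy_point _)) r))
  step_sub τ σ a _ _ := Subtype.ext
    ((d.step_sub τ (M.tySub_lift_inst τ σ _ a) _ (B.arity_eq σ a) _ _).trans
      (d.val_congr rfl rfl rfl))

theorem toStep_iff (r : M.Term (D.openTy M.nil)) {Γ : C} (σ : Γ ⟶ M.nil)
    (a : M.Term (M.tySub σ (L.ty M.nil)))
    (f : M.Term (M.tySub (M.wk (WFormers.Arity (B.openTy M.nil) σ a))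
      (T.WAt (B.openTy M.nil) σ))) :
    M.sub (T.consTree σ (T.sup a f)) rfl r =
        d.toStep.step σ a f (M.sub (T.consFam σ f) rfl r) ↔
      (D.sectionEquiv r).app (B.sup T _ (B.arity_eq σ a) (M.castTm (B.tySub_wk_wAt σ _) f)) =
        d.step _ (B.arity_eq σ a) _ ((D.sectionEquiv r).app _) := by
  have hl : (M.sub (T.consTree σ (T.sup a f)) rfl r).1 = ((D.sectionEquiv r).app
      (B.sup T _ (B.arity_eq σ a) (M.castTm (B.tySub_wk_wAt σ _) f))).1 :=
    congrArg (M.tmSub · r.1) (B.consTree_sup σ a f)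
  have hr : (d.toStep.step σ a f (M.sub (T.consFam σ f) rfl r)).1 =
      (d.step _ (B.arity_eq σ a) (M.castTm (B.tySub_wk_wAt σ _) f)
        ((D.sectionEquiv r).app _)).1 :=
    d.val_congr rfl rfl (congrArg (M.tmSub · r.1) (B.consFam_eq_point σ f))
  exact ⟨fun h => Subtype.ext (hl.symm.trans ((congrArg Subtype.val h).trans hr)),
    fun h => Subtype.ext (hl.trans ((congrArg Subtype.val h).trans hr.symm))⟩

variable {T : M.WTypes} {D : ClosedFam (B.wTy T.toWFormers)} (d : B.Step T.toWFormers D)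

theorem existsUnique_section :
    ∃! s : D.Section, ∀ {Γ : C} {A : M.Ty Γ} (a : L.Tm Γ) (hA : B.fam a = A)
      (f : (B.wTy T.toWFormers).Tm (M.ext Γ A)),
      s.app (B.sup T.toWFormers a hA f) = d.step a hA f (s.app f) := by
  refine (Equiv.existsUnique_congr D.sectionEquiv fun r => ?_).mp (T.W_elim _ d.toStep)
  refine ⟨fun h Γ A a hA f => ?_, fun h Γ σ a f => (d.toStep_iff r σ a f).mpr (h _ _ _)⟩
  let σ := M.nilTerminal.from Γ
  obtain rfl := hA.symm.trans (B.arity_eq σ (M.castTm (L.ty_sub σ).symm a))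
  exact (d.toStep_iff r σ (M.castTm (L.ty_sub σ).symm a)
    (M.castTm (B.tySub_wk_wAt σ _).symm f)).mp (h _ _ _)

/-- The dependent eliminator of the trees of `B.wTy T`. -/
noncomputable def elim : D.Section := d.existsUnique_section.choose

theorem elim_sup {Γ : C} {A : M.Ty Γ} (a : L.Tm Γ) (hA : B.fam a = A)
    (f : (B.wTy T.toWFormers).Tm (M.ext Γ A)) :
    d.elim.app (B.sup T.toWFormers a hA f) = d.step a hA f (d.elim.app f) :=
  d.existsUnique_section.choose_spec.1 a hA f

theorem eq_elim {s : D.Section}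
    (hs : ∀ {Γ : C} {A : M.Ty Γ} (a : L.Tm Γ) (hA : B.fam a = A)
      (f : (B.wTy T.toWFormers).Tm (M.ext Γ A)),
      s.app (B.sup T.toWFormers a hA f) = d.step a hA f (s.app f)) : s = d.elim :=
  d.existsUnique_section.choose_spec.2 s hs

end Step

end Elimination

section Injectivity

variable (T : M.WTypes) (P : M.PiTypes)

/-- The recursion computing the root label of a tree. -/
def labelStep : B.Step T.toWFormers (const _ L) where
  step a _ _ _ := a
  step_sub _ _ _ _ _ _ _ _ := rfl

variable {T} in
/-- The label at the root of a tree. -/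
noncomputable def label {Γ : C} (t : (B.wTy T.toWFormers).Tm Γ) : L.Tm Γ :=
  (B.labelStep T).elim.app t

theorem label_sup {Γ : C} {A : M.Ty Γ} (a : L.Tm Γ) (hA : B.fam a = A)
    (f : (B.wTy T.toWFormers).Tm (M.ext Γ A)) : B.label (B.sup T.toWFormers a hA f) = a :=
  (B.labelStep T).elim_sup a hA f

/-- The closed family of the types of families of subtrees of a tree. -/
noncomputable def subtreesFam : ClosedFam (B.wTy T.toWFormers) where
  fam t := P.Pi (B.fam (B.label t)) ((B.wTy T.toWFormers).ty _)
  fam_sub σ t := P.Pi_tySub σ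
    ((B.fam_sub σ _).trans (congrArg B.fam ((B.labelStep T).elim.app_sub σ t)))
    ((B.wTy T.toWFormers).ty_sub _)

/-- The recursion computing the family of subtrees of a tree. -/
noncomputable def subtreesStep : B.Step T.toWFormers (B.subtreesFam T P) where
  step a hA f _ := M.castTm
    (congrArg (fun A => P.Pi A ((B.wTy T.toWFormers).ty _))
      (hA.symm.trans (congrArg B.fam (B.label_sup T a hA f).symm))) (P.lam f)
  step_sub σ _ _ hσ _ _ f _ := P.lam_tmSub σ hσ ((B.wTy T.toWFormers).ty_sub _) f

variable {T}

/- The subtrees cannot be recovered by a non-dependent recursion, since the type indexing them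
depends on the root label. -/
include P in
theorem sup_injective {Γ : C} {A A' : M.Ty Γ} {a a' : L.Tm Γ} (hA : B.fam a = A)
    (hA' : B.fam a' = A') {f : (B.wTy T.toWFormers).Tm (M.ext Γ A)}
    {f' : (B.wTy T.toWFormers).Tm (M.ext Γ A')}
    (h : B.sup T.toWFormers a hA f = B.sup T.toWFormers a' hA' f') : a = a' ∧ HEq f f' := by
  obtain rfl : a = a' := by rw [← B.label_sup T a hA f, h, B.label_sup]
  obtain rfl : A = A' := hA.symm.trans hA'
  let subtrees := (B.subtreesStep T P).elim
  have hlam : P.lam f = P.lam f' := Subtype.ext <| calc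
    (P.lam f).1 = (subtrees.app (B.sup T.toWFormers a hA f)).1 :=
      (congrArg Subtype.val ((B.subtreesStep T P).elim_sup a hA f)).symm
    _ = (subtrees.app (B.sup T.toWFormers a hA' f')).1 := subtrees.val_congr h
    _ = (P.lam f').1 := congrArg Subtype.val ((B.subtreesStep T P).elim_sup a hA' f')
  exact ⟨rfl, heq_of_eq ((P.lam_bijective _ _).1 hlam)⟩

end Injectivity

end ClosedFam

namespace FiniteTypes

variable (F : M.FiniteTypes) {X Y : M.ClosedTy}

theorem zero_ext {Γ : C} {D : M.Ty (M.ext Γ (F.Zero Γ))} (s t : M.Term D) : s = t :=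
  (F.zero_elim D).unique trivial trivial

theorem inst_tt_comp_lift {Γ Δ : C} (σ : Δ ⟶ Γ) :
    M.inst (F.tt Δ) ≫ M.lift σ (F.Two_sub σ) = σ ≫ M.inst (F.tt Γ) := by
  rw [M.inst_comp σ (F.Two_sub σ), F.tt_sub]

theorem inst_ff_comp_lift {Γ Δ : C} (σ : Δ ⟶ Γ) :
    M.inst (F.ff Δ) ≫ M.lift σ (F.Two_sub σ) = σ ≫ M.inst (F.ff Γ) := by
  rw [M.inst_comp σ (F.Two_sub σ), F.ff_sub]

theorem existsUnique_boolElim {Γ : C} (s t : Y.Tm Γ) :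
    ∃! r : Y.Tm (M.ext Γ (F.Two Γ)),
      Y.sub (M.inst (F.tt Γ)) r = s ∧ Y.sub (M.inst (F.ff Γ)) r = t := by
  obtain ⟨r, ⟨hs, ht⟩, hr⟩ := F.two_elim (Y.ty _) (M.castTm (Y.ty_sub _).symm s)
    (M.castTm (Y.ty_sub _).symm t)
  refine ⟨r, ⟨Subtype.ext ?_, Subtype.ext ?_⟩, fun r' h => hr r' ⟨Subtype.ext ?_, Subtype.ext ?_⟩⟩
  exacts [(congrArg Subtype.val hs :), (congrArg Subtype.val ht :), (congrArg Subtype.val h.1 :),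
    (congrArg Subtype.val h.2 :)]

/-- The function from the booleans to a closed type with the values `s` and `t`, as a term
depending on a boolean variable. -/
noncomputable def boolElim {Γ : C} (s t : Y.Tm Γ) : Y.Tm (M.ext Γ (F.Two Γ)) :=
  (F.existsUnique_boolElim s t).choose

theorem sub_tt_boolElim {Γ : C} (s t : Y.Tm Γ) :
    Y.sub (M.inst (F.tt Γ)) (F.boolElim s t) = s :=
  (F.existsUnique_boolElim s t).choose_spec.1.1

theorem sub_ff_boolElim {Γ : C} (s t : Y.Tm Γ) :
    Y.sub (M.inst (F.ff Γ)) (F.boolElim s t) = t :=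
  (F.existsUnique_boolElim s t).choose_spec.1.2

theorem eq_boolElim {Γ : C} {s t : Y.Tm Γ} {r : Y.Tm (M.ext Γ (F.Two Γ))}
    (hs : Y.sub (M.inst (F.tt Γ)) r = s) (ht : Y.sub (M.inst (F.ff Γ)) r = t) :
    r = F.boolElim s t :=
  (F.existsUnique_boolElim s t).choose_spec.2 r ⟨hs, ht⟩

theorem sub_boolElim {Γ Δ : C} (σ : Δ ⟶ Γ) (s t : Y.Tm Γ) :
    Y.sub (M.lift σ (F.Two_sub σ)) (F.boolElim s t) = F.boolElim (Y.sub σ s) (Y.sub σ t) := by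
  apply F.eq_boolElim
  · rw [Y.sub_sub, F.inst_tt_comp_lift, ← Y.sub_sub, F.sub_tt_boolElim]
  · rw [Y.sub_sub, F.inst_ff_comp_lift, ← Y.sub_sub, F.sub_ff_boolElim]

theorem app_boolElim (G : (ClosedFam.const X Y).Section) {Γ : C} (s t : X.Tm Γ) :
    G.app (F.boolElim s t) = F.boolElim (G.app s) (G.app t) := by
  apply F.eq_boolElim
  · rw [G.sub_app, F.sub_tt_boolElim]
  · rw [G.sub_app, F.sub_ff_boolElim]

theorem boolElim_injective {Γ : C} {s s' t t' : Y.Tm Γ}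
    (h : F.boolElim s t = F.boolElim s' t') : s = s' ∧ t = t' := by
  constructor
  · rw [← F.sub_tt_boolElim s t, h, F.sub_tt_boolElim]
  · rw [← F.sub_ff_boolElim s t, h, F.sub_ff_boolElim]

end FiniteTypes

namespace Universes

variable (U : M.Universes)

/-- The universe `U i` as a closed type. -/
abbrev univ (i : ℕ) : M.ClosedTy where
  ty := U.U i
  ty_sub := U.U_sub i

/-- The decoding of the codes of `U i` as a closed family. -/
abbrev elFam (i : ℕ) : ClosedFam (U.univ i) where
  fam := U.El
  fam_sub := U.El_sub

variable {U}

theorem classified_le {V : M.Universes} {i : ℕ} (c : U.Code i (M.ext M.nil (V.U i M.nil)))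
    (hc : U.El c = V.El (V.univCode i)) : V.classified i ≤ U.classified i := by
  rintro X Y f ⟨g, d, h⟩
  have hp : M.tySub ((U.univ i).point c) (U.El (U.univCode i)) = V.El (V.univCode i) :=
    ((U.elFam i).openTy_point c).trans hc
  exact ⟨_, _, h.paste_horiz (isPullback_lift _ hp)⟩

end Universes

namespace Hierarchy

variable {T : M.ExtTT} {U : M.Hierarchy T}

section Trees

variable (U) in
/-- The closed type of well-founded trees branching over the types with a code in `U i`, that is,
the trees of Aczel's iterative sets. They serve as tags recording how a code has been formed. -/
abbrev tree (i : ℕ) : M.ClosedTy := (U.elFam i).wTy T.toWFormers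

variable {i j k : ℕ} {Γ Δ : C}

/-- The tree whose subtrees are given by the family `c`, indexed by the type with code `n`. -/
abbrev node {A : M.Ty Γ} (n : U.Code i Γ) (h : U.El n = A) (c : (U.tree i).Tm (M.ext Γ A)) :
    (U.tree i).Tm Γ :=
  (U.elFam i).sup T.toWFormers n h c

variable (U) in
/-- The recursion coercing trees from level `i` to level `j`: it coerces the codes of the indexing
types and leaves the shape of the tree unchanged. -/
def treeCumStep (h : i ≤ j) : (U.elFam i).Step T.toWFormers (.const _ (U.tree j)) where
  step n hA _ r := U.node (U.cum h n) ((U.El_cum h n).symm.trans hA) r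
  step_sub σ _ _ hσ n _ _ r := congrArg Subtype.val
    (((U.elFam j).sub_sup σ hσ (U.cum h n) _ r).trans
      ((U.elFam j).sup_congr (U.cum_sub h σ n) _ rfl))

/-- The coercion of trees from level `i` to level `j`. -/
noncomputable def treeCum (h : i ≤ j) (t : (U.tree i).Tm Γ) : (U.tree j).Tm Γ :=
  (U.treeCumStep h).elim.app t

theorem treeCum_node (h : i ≤ j) {A : M.Ty Γ} (n : U.Code i Γ) (hA : U.El n = A)
    (c : (U.tree i).Tm (M.ext Γ A)) :
    U.treeCum h (node n hA c) =
      node (U.cum h n) ((U.El_cum h n).symm.trans hA) (U.treeCum h c) :=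
  (U.treeCumStep h).elim_sup n hA c

theorem sub_treeCum (h : i ≤ j) (σ : Δ ⟶ Γ) (t : (U.tree i).Tm Γ) :
    (U.tree j).sub σ (U.treeCum h t) = U.treeCum h ((U.tree i).sub σ t) :=
  (U.treeCumStep h).elim.sub_app σ t

theorem treeCum_refl (t : (U.tree i).Tm Γ) : U.treeCum le_rfl t = t := by
  let idMap : (ClosedFam.const (U.tree i) (U.tree i)).Section := ⟨id, fun _ _ => rfl⟩
  have h : idMap = (U.treeCumStep le_rfl).elim := (U.treeCumStep le_rfl).eq_elim fun n hA _ =>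
    (U.elFam i).sup_congr (U.cum_refl n).symm hA rfl
  exact congrArg (·.app t) h.symm

theorem treeCum_trans (h : i ≤ j) (h' : j ≤ k) (t : (U.tree i).Tm Γ) :
    U.treeCum h' (U.treeCum h t) = U.treeCum (h.trans h') t := by
  let compMap : (ClosedFam.const (U.tree i) (U.tree k)).Section :=
    ⟨fun t => U.treeCum h' (U.treeCum h t), fun σ t =>
      (sub_treeCum h' σ _).trans (congrArg (U.treeCum h') (sub_treeCum h σ t))⟩
  have hc : compMap = (U.treeCumStep (h.trans h')).elim :=
    (U.treeCumStep (h.trans h')).eq_elim fun n hA c => calc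
      U.treeCum h' (U.treeCum h (node n hA c))
      _ = node (U.cum h' (U.cum h n)) _ (U.treeCum h' (U.treeCum h c)) := by
        rw [treeCum_node, treeCum_node]
      _ = _ := (U.elFam k).sup_congr (U.cum_trans h h' n) _ rfl
  exact congrArg (·.app t) hc

/-- The tree without subtrees. -/
noncomputable def leaf (U : M.Hierarchy T) (i : ℕ) (Γ : C) : (U.tree i).Tm Γ :=
  node (U.zero i Γ) (U.El_zero i Γ) (T.zero_elim ((U.tree i).ty _)).choose

theorem sub_leaf (σ : Δ ⟶ Γ) : (U.tree i).sub σ (U.leaf i Γ) = U.leaf i Δ :=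
  ((U.elFam i).sub_sup σ (T.Zero_sub σ) _ (U.El_zero i Γ) _).trans
    ((U.elFam i).sup_congr (U.zero_sub i σ) _ (T.zero_ext _ _))

theorem treeCum_leaf (h : i ≤ j) : U.treeCum h (U.leaf i Γ) = U.leaf j Γ :=
  (treeCum_node h _ (U.El_zero i Γ) _).trans
    ((U.elFam j).sup_congr (U.cum_zero h Γ) _ (T.zero_ext _ _))

/-- The tree with the two subtrees `s` and `t`. -/
noncomputable def pairTree (s t : (U.tree i).Tm Γ) : (U.tree i).Tm Γ :=
  node (U.two i Γ) (U.El_two i Γ) (T.boolElim s t)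

theorem sub_pairTree (σ : Δ ⟶ Γ) (s t : (U.tree i).Tm Γ) :
    (U.tree i).sub σ (pairTree s t) = pairTree ((U.tree i).sub σ s) ((U.tree i).sub σ t) :=
  ((U.elFam i).sub_sup σ (T.Two_sub σ) _ (U.El_two i Γ) _).trans
    ((U.elFam i).sup_congr (U.two_sub i σ) _ (T.sub_boolElim σ s t))

theorem treeCum_pairTree (h : i ≤ j) (s t : (U.tree i).Tm Γ) :
    U.treeCum h (pairTree s t) = pairTree (U.treeCum h s) (U.treeCum h t) :=
  (treeCum_node h _ (U.El_two i Γ) _).trans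
    ((U.elFam j).sup_congr (U.cum_two h Γ) _ (T.app_boolElim (U.treeCumStep h).elim s t))

theorem pairTree_injective {s s' t t' : (U.tree i).Tm Γ} (h : pairTree s t = pairTree s' t') :
    s = s' ∧ t = t' :=
  T.boolElim_injective (eq_of_heq
    ((U.elFam i).sup_injective T.toPiTypes (U.El_two i Γ) (U.El_two i Γ) h).2)

/-- The tree recording the code `d`: all subtrees of its node, which is labelled `d`, are leaves. -/
noncomputable def codeTree (d : U.Code i Γ) : (U.tree i).Tm Γ :=
  node d rfl (U.leaf i _)

theorem sub_codeTree (σ : Δ ⟶ Γ) (d : U.Code i Γ) :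
    (U.tree i).sub σ (codeTree d) = codeTree (U.codeSub σ d) :=
  ((U.elFam i).sub_sup σ (U.El_sub σ d) d rfl _).trans
    ((U.elFam i).sup_congr rfl _ (sub_leaf _))

theorem treeCum_codeTree (h : i ≤ j) (d : U.Code i Γ) :
    U.treeCum h (codeTree d) = codeTree (U.cum h d) := by
  rw [codeTree, treeCum_node, treeCum_leaf, ← sub_leaf (M.castCtx (U.El_cum h d).symm)]
  exact (U.elFam j).sup_castCtx (U.El_cum h d).symm (U.cum h d) rfl (U.leaf j _)

theorem codeTree_injective : Function.Injective (codeTree : U.Code i Γ → (U.tree i).Tm Γ) :=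
  fun _ _ h => ((U.elFam i).sup_injective T.toPiTypes rfl rfl h).1

end Trees

section Tagged

variable {i j k : ℕ} {Γ Δ : C}

variable (U) in
/-- The codes of `U i` tagged by a tree, which is to record how the code has been formed. They are
the codes of the replacement of `U`. -/
abbrev tagged (i : ℕ) : M.ClosedTy := ClosedTy.prod (U.univ i) T.toSigmaTypes (U.tree i)

/-- The code of `U i` underlying a tagged code. -/
noncomputable def code (a : (U.tagged i).Tm Γ) : U.Code i Γ := ClosedTy.fst a

/-- The tag of a tagged code. -/
noncomputable def tag (a : (U.tagged i).Tm Γ) : (U.tree i).Tm Γ := ClosedTy.snd a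

/-- The code `n` with the tag `t`. -/
def withTag (n : U.Code i Γ) (t : (U.tree i).Tm Γ) : (U.tagged i).Tm Γ :=
  ClosedTy.pair T.toSigmaTypes n t

theorem code_withTag (n : U.Code i Γ) (t : (U.tree i).Tm Γ) : code (withTag n t) = n :=
  ClosedTy.fst_pair (X := U.univ i) n t

theorem tag_withTag (n : U.Code i Γ) (t : (U.tree i).Tm Γ) : tag (withTag n t) = t :=
  ClosedTy.snd_pair (X := U.univ i) n t

theorem withTag_code_tag (a : (U.tagged i).Tm Γ) : withTag (code a) (tag a) = a :=
  ClosedTy.pair_fst_snd a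

theorem ext_code_tag {a a' : (U.tagged i).Tm Γ} (hc : code a = code a') (ht : tag a = tag a') :
    a = a' := by
  rw [← withTag_code_tag a, hc, ht, withTag_code_tag]

theorem sub_code (σ : Δ ⟶ Γ) (a : (U.tagged i).Tm Γ) :
    U.codeSub σ (code a) = code ((U.tagged i).sub σ a) :=
  ClosedTy.sub_fst σ a

theorem sub_tag (σ : Δ ⟶ Γ) (a : (U.tagged i).Tm Γ) :
    (U.tree i).sub σ (tag a) = tag ((U.tagged i).sub σ a) :=
  ClosedTy.sub_snd σ a

theorem sub_withTag (σ : Δ ⟶ Γ) (n : U.Code i Γ) (t : (U.tree i).Tm Γ) :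
    (U.tagged i).sub σ (withTag n t) = withTag (U.codeSub σ n) ((U.tree i).sub σ t) :=
  ClosedTy.sub_pair (X := U.univ i) _ σ n t

variable (U) in
/-- The decoding of tagged codes, which ignores the tag. -/
noncomputable abbrev taggedFam (i : ℕ) : ClosedFam (U.tagged i) where
  fam a := U.El (code a)
  fam_sub σ a := (U.El_sub σ _).trans (congrArg U.El (sub_code σ a))

/-- The coercion of tagged codes from level `i` to level `j`. -/
noncomputable def taggedCum (h : i ≤ j) (a : (U.tagged i).Tm Γ) : (U.tagged j).Tm Γ :=
  withTag (U.cum h (code a)) (U.treeCum h (tag a))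

theorem code_taggedCum (h : i ≤ j) (a : (U.tagged i).Tm Γ) :
    code (taggedCum h a) = U.cum h (code a) :=
  code_withTag _ _

theorem tag_taggedCum (h : i ≤ j) (a : (U.tagged i).Tm Γ) :
    tag (taggedCum h a) = U.treeCum h (tag a) :=
  tag_withTag _ _

theorem El_code_taggedCum (h : i ≤ j) (a : (U.tagged i).Tm Γ) :
    U.El (code a) = U.El (code (taggedCum h a)) := by
  rw [code_taggedCum, ← U.El_cum]

theorem sub_taggedCum (h : i ≤ j) (σ : Δ ⟶ Γ) (a : (U.tagged i).Tm Γ) :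
    (U.tagged j).sub σ (taggedCum h a) = taggedCum h ((U.tagged i).sub σ a) := by
  rw [taggedCum, sub_withTag, sub_treeCum, U.cum_sub, sub_code, sub_tag, taggedCum]

theorem taggedCum_refl (a : (U.tagged i).Tm Γ) : taggedCum le_rfl a = a := by
  rw [taggedCum, U.cum_refl, treeCum_refl, withTag_code_tag]

theorem taggedCum_trans (h : i ≤ j) (h' : j ≤ k) (a : (U.tagged i).Tm Γ) :
    taggedCum h' (taggedCum h a) = taggedCum (h.trans h') a := by
  rw [taggedCum, code_taggedCum, tag_taggedCum, U.cum_trans, treeCum_trans, taggedCum]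

/-- The tagged code whose tag is a leaf. -/
noncomputable def untagged (n : U.Code i Γ) : (U.tagged i).Tm Γ := withTag n (U.leaf i Γ)

theorem sub_untagged (σ : Δ ⟶ Γ) (n : U.Code i Γ) :
    (U.tagged i).sub σ (untagged n) = untagged (U.codeSub σ n) := by
  rw [untagged, sub_withTag, sub_leaf, untagged]

theorem taggedCum_untagged (h : i ≤ j) (n : U.Code i Γ) :
    taggedCum h (untagged n) = untagged (U.cum h n) := by
  rw [taggedCum, untagged, code_withTag, tag_withTag, treeCum_leaf, untagged]

theorem code_untagged (n : U.Code i Γ) : code (untagged n) = n :=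
  code_withTag n _

theorem El_code_untagged {A : M.Ty Γ} {n : U.Code i Γ} (h : U.El n = A) :
    U.El (code (untagged n)) = A := by
  rw [code_untagged, h]

theorem sub_untagged_of_eq {σ : Δ ⟶ Γ} {n : U.Code i Γ} {n' : U.Code i Δ}
    (h : U.codeSub σ n = n') : (U.tagged i).sub σ (untagged n) = untagged n' := by
  rw [sub_untagged, h]

theorem taggedCum_untagged_of_eq {h : i ≤ j} {n : U.Code i Γ} {n' : U.Code j Γ}
    (hn : U.cum h n = n') : taggedCum h (untagged n) = untagged n' := by
  rw [taggedCum_untagged, hn]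

/-- A tree recording a tagged code. -/
noncomputable def encode (a : (U.tagged i).Tm Γ) : (U.tree i).Tm Γ :=
  pairTree (codeTree (code a)) (tag a)

theorem sub_encode (σ : Δ ⟶ Γ) (a : (U.tagged i).Tm Γ) :
    (U.tree i).sub σ (encode a) = encode ((U.tagged i).sub σ a) := by
  rw [encode, sub_pairTree, sub_codeTree, sub_code, sub_tag, encode]

theorem treeCum_encode (h : i ≤ j) (a : (U.tagged i).Tm Γ) :
    U.treeCum h (encode a) = encode (taggedCum h a) := by
  rw [encode, treeCum_pairTree, treeCum_codeTree, encode, code_taggedCum, tag_taggedCum]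

theorem encode_injective : Function.Injective (encode : (U.tagged i).Tm Γ → (U.tree i).Tm Γ) :=
  fun _ _ h => ext_code_tag (codeTree_injective (pairTree_injective h).1) (pairTree_injective h).2

/-- The tree recording a tagged code `a` and a family `c` of trees indexed by its decoding. -/
noncomputable def famTree {A : M.Ty Γ} (a : (U.tagged i).Tm Γ) (hA : U.El (code a) = A)
    (c : (U.tree i).Tm (M.ext Γ A)) : (U.tree i).Tm Γ :=
  pairTree (tag a) (node (code a) hA c)

theorem sub_famTree (σ : Δ ⟶ Γ) {A : M.Ty Γ} {A' : M.Ty Δ} (hσ : M.tySub σ A = A')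
    (a : (U.tagged i).Tm Γ) (hA : U.El (code a) = A) (c : (U.tree i).Tm (M.ext Γ A)) :
    (U.tree i).sub σ (famTree a hA c) = famTree ((U.tagged i).sub σ a)
      ((U.taggedFam i).fam_sub_of_eq σ hA hσ) ((U.tree i).sub (M.lift σ hσ) c) := by
  rw [famTree, sub_pairTree, sub_tag, famTree, (U.elFam i).sub_sup σ hσ]
  exact congrArg _ ((U.elFam i).sup_congr (sub_code σ a) _ rfl)

theorem treeCum_famTree (h : i ≤ j) {A : M.Ty Γ} (a : (U.tagged i).Tm Γ)
    (hA : U.El (code a) = A) (c : (U.tree i).Tm (M.ext Γ A)) :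
    U.treeCum h (famTree a hA c) =
      famTree (taggedCum h a) ((El_code_taggedCum h a).symm.trans hA) (U.treeCum h c) := by
  rw [famTree, treeCum_pairTree, treeCum_node, famTree, tag_taggedCum]
  exact congrArg _ ((U.elFam j).sup_congr (code_taggedCum h a).symm _ rfl)

theorem famTree_injective {A A' : M.Ty Γ} {a a' : (U.tagged i).Tm Γ} (hA : U.El (code a) = A)
    (hA' : U.El (code a') = A') {c : (U.tree i).Tm (M.ext Γ A)}
    {c' : (U.tree i).Tm (M.ext Γ A')} (h : famTree a hA c = famTree a' hA' c') :
    a = a' ∧ HEq c c' := by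
  obtain ⟨htag, hnode⟩ := pairTree_injective h
  obtain ⟨hcode, hc⟩ := (U.elFam i).sup_injective T.toPiTypes hA hA' hnode
  exact ⟨ext_code_tag hcode htag, hc⟩

end Tagged

section Binders

variable {i j : ℕ} {Γ Δ : C} {F : ∀ {Γ : C} (A : M.Ty Γ), M.Ty (M.ext Γ A) → M.Ty Γ}

variable (U F) in
/-- Codes in the hierarchy `U` for a type former `F` which binds a variable, such as `Pi`, `Sig`
and `W`. -/
structure Binder where
  op {i : ℕ} {Γ : C} (a : U.Code i Γ) (b : U.Code i (M.ext Γ (U.El a))) : U.Code i Γ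
  sub_op {i : ℕ} {Γ Δ : C} (σ : Δ ⟶ Γ) (a : U.Code i Γ) (b : U.Code i (M.ext Γ (U.El a))) :
    U.codeSub σ (op a b) = op (U.codeSub σ a) (U.codeSub (U.liftEl σ a) b)
  El_op {i : ℕ} {Γ : C} (a : U.Code i Γ) (b : U.Code i (M.ext Γ (U.El a))) :
    U.El (op a b) = F (U.El a) (U.El b)
  cum_op {i j : ℕ} (h : i ≤ j) {Γ : C} (a : U.Code i Γ) (b : U.Code i (M.ext Γ (U.El a))) :
    U.cum h (op a b) = op (U.cum h a) (U.cum h (U.codeSub (M.castCtx (U.El_cum h a)) b))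

variable (U) in
/-- The codes of dependent products. -/
def piBinder : U.Binder T.Pi := ⟨U.pi, U.pi_sub, U.El_pi, U.cum_pi⟩

variable (U) in
/-- The codes of dependent sums. -/
def sgBinder : U.Binder T.Sig := ⟨U.sg, U.sg_sub, U.El_sg, U.cum_sg⟩

variable (U) in
/-- The codes of `W`-types. -/
def wtBinder : U.Binder T.W := ⟨U.wt, U.wt_sub, U.El_wt, U.cum_wt⟩

namespace Binder

variable (φ : U.Binder F)

/-- The operation of a binder on a code `a` and a family of codes indexed by any type equal to
`U.El a`. -/
def app {A : M.Ty Γ} (a : U.Code i Γ) (hA : U.El a = A) (b : U.Code i (M.ext Γ A)) :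
    U.Code i Γ :=
  φ.op a (U.codeSub (M.castCtx hA.symm) b)

theorem app_rfl (a : U.Code i Γ) (b : U.Code i (M.ext Γ (U.El a))) : φ.app a rfl b = φ.op a b :=
  congrArg (φ.op a) ((U.univ i).sub_castCtx_rfl rfl b)

theorem app_congr {A : M.Ty Γ} {a a' : U.Code i Γ} (ha : a = a') (hA : U.El a = A)
    {b b' : U.Code i (M.ext Γ A)} (hb : b = b') : φ.app a hA b = φ.app a' (ha ▸ hA) b' := by
  subst ha hb
  rfl

theorem sub_app (σ : Δ ⟶ Γ) {A : M.Ty Γ} {A' : M.Ty Δ} (hσ : M.tySub σ A = A')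
    (a : U.Code i Γ) (hA : U.El a = A) (b : U.Code i (M.ext Γ A)) :
    U.codeSub σ (φ.app a hA b) = φ.app (U.codeSub σ a) ((U.elFam i).fam_sub_of_eq σ hA hσ)
      (U.codeSub (M.lift σ hσ) b) := by
  subst hA
  obtain rfl := (U.El_sub σ a).symm.trans hσ
  rw [app_rfl, app_rfl, φ.sub_op]

theorem El_app {A : M.Ty Γ} (a : U.Code i Γ) (hA : U.El a = A) (b : U.Code i (M.ext Γ A)) :
    U.El (φ.app a hA b) = F A (U.El b) := by
  subst hA
  rw [app_rfl, φ.El_op]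

theorem cum_app (h : i ≤ j) {A : M.Ty Γ} (a : U.Code i Γ) (hA : U.El a = A)
    (b : U.Code i (M.ext Γ A)) :
    U.cum h (φ.app a hA b) =
      φ.app (U.cum h a) ((U.El_cum h a).symm.trans hA) (U.cum h b) := by
  subst hA
  rw [app_rfl, φ.cum_op, ← U.cum_sub]
  rfl

/-- The operation of a binder on tagged codes. The arguments are recorded in the tag. -/
noncomputable def tagged {A : M.Ty Γ} (a : (U.tagged i).Tm Γ) (hA : U.El (code a) = A)
    (b : (U.tagged i).Tm (M.ext Γ A)) : (U.tagged i).Tm Γ :=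
  withTag (φ.app (code a) hA (code b)) (famTree a hA (encode b))

theorem code_tagged {A : M.Ty Γ} (a : (U.tagged i).Tm Γ) (hA : U.El (code a) = A)
    (b : (U.tagged i).Tm (M.ext Γ A)) : code (φ.tagged a hA b) = φ.app (code a) hA (code b) :=
  code_withTag _ _

theorem sub_tagged (σ : Δ ⟶ Γ) {A : M.Ty Γ} {A' : M.Ty Δ} (hσ : M.tySub σ A = A')
    (a : (U.tagged i).Tm Γ) (hA : U.El (code a) = A) (b : (U.tagged i).Tm (M.ext Γ A)) :
    (U.tagged i).sub σ (φ.tagged a hA b) = φ.tagged ((U.tagged i).sub σ a)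
      ((U.taggedFam i).fam_sub_of_eq σ hA hσ) ((U.tagged i).sub (M.lift σ hσ) b) := by
  rw [tagged, sub_withTag, φ.sub_app σ hσ, sub_famTree σ hσ, sub_encode]
  exact congrArg (withTag · _) (φ.app_congr (sub_code σ a) _ (sub_code _ b))

theorem taggedCum_tagged (h : i ≤ j) {A : M.Ty Γ} (a : (U.tagged i).Tm Γ)
    (hA : U.El (code a) = A) (b : (U.tagged i).Tm (M.ext Γ A)) :
    taggedCum h (φ.tagged a hA b) =
      φ.tagged (taggedCum h a) ((El_code_taggedCum h a).symm.trans hA) (taggedCum h b) := by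
  rw [taggedCum, tagged, code_withTag, tag_withTag, φ.cum_app, treeCum_famTree,
    treeCum_encode]
  exact congrArg (withTag · _)
    (φ.app_congr (code_taggedCum h a).symm _ (code_taggedCum h b).symm)

theorem tagged_castCtx {A A' : M.Ty Γ} (e : A = A') (a : (U.tagged i).Tm Γ)
    (hA : U.El (code a) = A) (b : (U.tagged i).Tm (M.ext Γ A)) :
    φ.tagged a (hA.trans e) ((U.tagged i).sub (M.castCtx e) b) = φ.tagged a hA b := by
  subst e
  rw [ClosedTy.sub_castCtx_rfl]

theorem El_code_tagged (a : (U.tagged i).Tm Γ) (b : (U.tagged i).Tm (M.ext Γ (U.El (code a)))) :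
    U.El (code (φ.tagged a rfl b)) = F (U.El (code a)) (U.El (code b)) := by
  rw [φ.code_tagged, φ.El_app]

theorem taggedCum_tagged_rfl (h : i ≤ j) (a : (U.tagged i).Tm Γ)
    (b : (U.tagged i).Tm (M.ext Γ (U.El (code a)))) :
    taggedCum h (φ.tagged a rfl b) = φ.tagged (taggedCum h a) rfl
      (taggedCum h ((U.tagged i).sub (M.castCtx (El_code_taggedCum h a)) b)) := by
  rw [φ.taggedCum_tagged, ← sub_taggedCum]
  exact (φ.tagged_castCtx (El_code_taggedCum h a) _ _ _).symm

theorem tagged_injective (i : ℕ) (Γ : C) : Function.Injective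
    fun x : (Σ a : (U.tagged i).Tm Γ, (U.tagged i).Tm (M.ext Γ (U.El (code a)))) =>
      φ.tagged x.1 rfl x.2 := by
  rintro ⟨a, b⟩ ⟨a', b'⟩ h
  have htree := congrArg tag h
  simp only [tagged, tag_withTag] at htree
  obtain ⟨rfl, hb⟩ := famTree_injective rfl rfl htree
  rw [encode_injective (eq_of_heq hb)]

end Binder

end Binders

section Equality

variable {i j : ℕ} {Γ Δ : C} {A : M.Ty Γ}

/-- The code of the equality type of two terms of any type equal to `U.El a`. -/
def eqCode (a : U.Code i Γ) (hA : U.El a = A) (s t : M.Term A) : U.Code i Γ :=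
  U.eq a (M.castTm hA.symm s) (M.castTm hA.symm t)

theorem eqCode_congr {a a' : U.Code i Γ} (ha : a = a') (hA : U.El a = A) {s s' t t' : M.Term A}
    (hs : s = s') (ht : t = t') : eqCode a hA s t = eqCode a' (ha ▸ hA) s' t' := by
  subst ha hs ht
  rfl

theorem sub_eqCode (σ : Δ ⟶ Γ) {A' : M.Ty Δ} (hσ : M.tySub σ A = A') (a : U.Code i Γ)
    (hA : U.El a = A) (s t : M.Term A) :
    U.codeSub σ (eqCode a hA s t) = eqCode (U.codeSub σ a)
      ((U.elFam i).fam_sub_of_eq σ hA hσ) (M.sub σ hσ s) (M.sub σ hσ t) := by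
  subst hA
  exact U.eq_sub σ a s t

theorem El_eqCode (a : U.Code i Γ) (hA : U.El a = A) (s t : M.Term A) :
    U.El (eqCode a hA s t) = T.EqTy s t := by
  subst hA
  exact U.El_eq a s t

theorem cum_eqCode (h : i ≤ j) (a : U.Code i Γ) (hA : U.El a = A) (s t : M.Term A) :
    U.cum h (eqCode a hA s t) = eqCode (U.cum h a) ((U.El_cum h a).symm.trans hA) s t := by
  subst hA
  exact U.cum_eq h a s t

/-- The code of the singleton `x = s`, depending on a variable `x : A`. It allows tags, which record
codes only, to record the term `s`. -/
def singletonCode (a : U.Code i Γ) (hA : U.El a = A) (s : M.Term A) : U.Code i (M.ext Γ A) :=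
  eqCode (U.codeSub (M.wk A) a) ((U.elFam i).fam_sub_of_eq (M.wk A) hA rfl)
    ⟨M.var A, M.tp_var A⟩ (M.sub (M.wk A) rfl s)

theorem sub_singletonCode (σ : Δ ⟶ Γ) {A' : M.Ty Δ} (hσ : M.tySub σ A = A') (a : U.Code i Γ)
    (hA : U.El a = A) (s : M.Term A) :
    U.codeSub (M.lift σ hσ) (singletonCode a hA s) = singletonCode (U.codeSub σ a)
      ((U.elFam i).fam_sub_of_eq σ hA hσ) (M.sub σ hσ s) := by
  have hwk : M.tySub (M.lift σ hσ) (M.tySub (M.wk A) A) = M.tySub (M.wk A') A' := by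
    rw [← M.tySub_comp, M.lift_wk, M.tySub_comp, hσ]
  exact (sub_eqCode _ hwk _ _ _ _).trans (eqCode_congr (sub_lift_sub_wk σ hσ _ _ _ _ a) _
    (Subtype.ext (tmSub_lift_var σ hσ)) (sub_lift_sub_wk σ hσ _ _ _ _ s))

theorem cum_singletonCode (h : i ≤ j) (a : U.Code i Γ) (hA : U.El a = A) (s : M.Term A) :
    U.cum h (singletonCode a hA s) =
      singletonCode (U.cum h a) ((U.El_cum h a).symm.trans hA) s :=
  (cum_eqCode h _ _ _ _).trans (eqCode_congr (U.cum_sub h (M.wk A) a).symm _ rfl rfl)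

theorem sub_inst_singletonCode (a : U.Code i Γ) (hA : U.El a = A) (s t : M.Term A) :
    U.codeSub (M.inst s) (singletonCode a hA t) = eqCode a hA s t := by
  have hwk : M.tySub (M.inst s) (M.tySub (M.wk A) A) = A := by
    rw [← M.tySub_comp, inst_wk, M.tySub_id]
  exact (sub_eqCode _ hwk _ _ _ _).trans (eqCode_congr (sub_inst_sub_wk s _ _ a) _
    (Subtype.ext (tmSub_inst_var s)) (sub_inst_sub_wk s _ _ t))

theorem singletonCode_injective (a : U.Code i Γ) (hA : U.El a = A) :
    Function.Injective (singletonCode a hA) := by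
  intro s t h
  have heq : eqCode a hA s s = eqCode a hA s t := by
    rw [← sub_inst_singletonCode, h, sub_inst_singletonCode]
  have hEq : T.EqTy s s = T.EqTy s t := by
    rw [← El_eqCode a hA, heq, El_eqCode]
  exact T.reflection (M.castTm hEq (T.refl s))

/-- The tagged code of the equality type of `s` and `t`. The arguments are recorded in the tag. -/
noncomputable def taggedEq (a : (U.tagged i).Tm Γ) (hA : U.El (code a) = A) (s t : M.Term A) :
    (U.tagged i).Tm Γ :=
  withTag (eqCode (code a) hA s t) (famTree a hA
    (pairTree (codeTree (singletonCode (code a) hA s)) (codeTree (singletonCode (code a) hA t))))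

theorem code_taggedEq (a : (U.tagged i).Tm Γ) (hA : U.El (code a) = A) (s t : M.Term A) :
    code (taggedEq a hA s t) = eqCode (code a) hA s t :=
  code_withTag _ _

theorem tag_taggedEq (a : (U.tagged i).Tm Γ) (hA : U.El (code a) = A) (s t : M.Term A) :
    tag (taggedEq a hA s t) = famTree a hA (pairTree (codeTree (singletonCode (code a) hA s))
      (codeTree (singletonCode (code a) hA t))) :=
  tag_withTag _ _

theorem El_code_taggedEq (a : (U.tagged i).Tm Γ) (s t : M.Term (U.El (code a))) :
    U.El (code (taggedEq a rfl s t)) = T.EqTy s t := by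
  rw [code_taggedEq, El_eqCode]

theorem sub_taggedEq (σ : Δ ⟶ Γ) {A' : M.Ty Δ} (hσ : M.tySub σ A = A') (a : (U.tagged i).Tm Γ)
    (hA : U.El (code a) = A) (s t : M.Term A) :
    (U.tagged i).sub σ (taggedEq a hA s t) = taggedEq ((U.tagged i).sub σ a)
      ((U.taggedFam i).fam_sub_of_eq σ hA hσ) (M.sub σ hσ s) (M.sub σ hσ t) := by
  rw [taggedEq, sub_withTag, sub_eqCode σ hσ, sub_famTree σ hσ, sub_pairTree, sub_codeTree,
    sub_codeTree, sub_singletonCode, sub_singletonCode]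
  simp only [taggedEq, sub_code]

theorem taggedCum_taggedEq (h : i ≤ j) (a : (U.tagged i).Tm Γ) (hA : U.El (code a) = A)
    (s t : M.Term A) :
    taggedCum h (taggedEq a hA s t) =
      taggedEq (taggedCum h a) ((El_code_taggedCum h a).symm.trans hA) s t := by
  rw [taggedCum, code_taggedEq, tag_taggedEq, cum_eqCode, treeCum_famTree, treeCum_pairTree,
    treeCum_codeTree, treeCum_codeTree, cum_singletonCode, cum_singletonCode]
  simp only [taggedEq, code_taggedCum]

theorem taggedEq_castTm {A' : M.Ty Γ} (e : A = A') (a : (U.tagged i).Tm Γ)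
    (hA : U.El (code a) = A) (s t : M.Term A) :
    taggedEq a (hA.trans e) (M.castTm e s) (M.castTm e t) = taggedEq a hA s t := by
  subst e
  rfl

theorem taggedCum_taggedEq_rfl (h : i ≤ j) (a : (U.tagged i).Tm Γ)
    (s t : M.Term (U.El (code a))) :
    taggedCum h (taggedEq a rfl s t) = taggedEq (taggedCum h a) rfl
      (M.castTm (El_code_taggedCum h a) s) (M.castTm (El_code_taggedCum h a) t) :=
  (taggedCum_taggedEq h a rfl s t).trans (taggedEq_castTm (El_code_taggedCum h a) _ _ s t).symm

theorem taggedEq_injective (i : ℕ) (Γ : C) : Function.Injective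
    fun x : (Σ a : (U.tagged i).Tm Γ, M.Term (U.El (code a)) × M.Term (U.El (code a))) =>
      taggedEq x.1 rfl x.2.1 x.2.2 := by
  rintro ⟨a, s, t⟩ ⟨a', s', t'⟩ h
  have htag := congrArg tag h
  simp only [tag_taggedEq] at htag
  obtain ⟨rfl, hst⟩ := famTree_injective rfl rfl htag
  obtain ⟨hs, ht⟩ := pairTree_injective (eq_of_heq hst)
  rw [singletonCode_injective _ _ (codeTree_injective hs),
    singletonCode_injective _ _ (codeTree_injective ht)]

end Equality

section UniverseCodes

variable {Γ Δ : C}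

variable (U) in
/-- The code of the closed type `U.tree i` in the next universe. -/
def treeTyCode (i : ℕ) (Γ : C) : U.Code (i + 1) Γ :=
  U.wtBinder.app (U.uni i.lt_succ_self Γ) (U.El_uni _ Γ) (U.cum i.le_succ ((U.univ i).var Γ))

theorem El_treeTyCode (i : ℕ) (Γ : C) : U.El (U.treeTyCode i Γ) = (U.tree i).ty Γ :=
  (U.wtBinder.El_app _ _ _).trans (congrArg (T.W _) (U.El_cum _ _).symm)

theorem sub_treeTyCode (i : ℕ) (σ : Δ ⟶ Γ) :
    U.codeSub σ (U.treeTyCode i Γ) = U.treeTyCode i Δ :=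
  (U.wtBinder.sub_app σ (U.U_sub i σ) _ _ _).trans
    (U.wtBinder.app_congr (U.uni_sub _ σ) _
      ((U.cum_sub _ _ _).trans (congrArg (U.cum _) ((U.univ i).sub_lift_var σ))))

variable (U) in
/-- The code of the closed type `U.tagged i` in the next universe. -/
def taggedTyCode (i : ℕ) (Γ : C) : U.Code (i + 1) Γ :=
  U.sgBinder.app (U.uni i.lt_succ_self Γ) (U.El_uni _ Γ) (U.treeTyCode i _)

theorem El_taggedTyCode (i : ℕ) (Γ : C) : U.El (U.taggedTyCode i Γ) = (U.tagged i).ty Γ :=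
  (U.sgBinder.El_app _ _ _).trans (congrArg (T.Sig _) (El_treeTyCode i _))

theorem sub_taggedTyCode (i : ℕ) (σ : Δ ⟶ Γ) :
    U.codeSub σ (U.taggedTyCode i Γ) = U.taggedTyCode i Δ :=
  (U.sgBinder.sub_app σ (U.U_sub i σ) _ _ _).trans
    (U.sgBinder.app_congr (U.uni_sub _ σ) _ (sub_treeTyCode i _))

end UniverseCodes

variable (U) in
/-- The hierarchy of the tagged codes of `U`. -/
noncomputable def taggedHierarchy : M.Hierarchy T where
  U i := (U.tagged i).ty
  U_sub i := (U.tagged i).ty_sub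
  El a := U.El (code a)
  El_sub := (U.taggedFam _).fam_sub
  cum h _ a := taggedCum h a
  cum_sub h _ _ σ a := sub_taggedCum h σ a
  cum_refl := taggedCum_refl
  cum_trans h h' _ a := taggedCum_trans h h' a
  El_cum h _ a := El_code_taggedCum h a
  uni {i _} h Γ := untagged (U.cum (Nat.succ_le_of_lt h) (U.taggedTyCode i Γ))
  uni_sub {i _} _ {_ _} σ :=
    sub_untagged_of_eq ((U.cum_sub _ σ _).trans (congrArg (U.cum _) (sub_taggedTyCode i σ)))
  El_uni {i _} _ Γ := El_code_untagged ((U.El_cum _ _).symm.trans (El_taggedTyCode i Γ))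
  cum_uni _ h' _ := taggedCum_untagged_of_eq (U.cum_trans _ h' _)
  pi a b := U.piBinder.tagged a rfl b
  pi_sub σ a b := U.piBinder.sub_tagged σ _ a rfl b
  El_pi a b := U.piBinder.El_code_tagged a b
  cum_pi h _ a b := U.piBinder.taggedCum_tagged_rfl h a b
  sg a b := U.sgBinder.tagged a rfl b
  sg_sub σ a b := U.sgBinder.sub_tagged σ _ a rfl b
  El_sg a b := U.sgBinder.El_code_tagged a b
  cum_sg h _ a b := U.sgBinder.taggedCum_tagged_rfl h a b
  wt a b := U.wtBinder.tagged a rfl b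
  wt_sub σ a b := U.wtBinder.sub_tagged σ _ a rfl b
  El_wt a b := U.wtBinder.El_code_tagged a b
  cum_wt h _ a b := U.wtBinder.taggedCum_tagged_rfl h a b
  eq a s t := taggedEq a rfl s t
  eq_sub σ a s t := sub_taggedEq σ _ a rfl s t
  El_eq := El_code_taggedEq
  cum_eq h _ a s t := taggedCum_taggedEq_rfl h a s t
  zero i Γ := untagged (U.zero i Γ)
  zero_sub i _ _ σ := sub_untagged_of_eq (U.zero_sub i σ)
  El_zero i Γ := El_code_untagged (U.El_zero i Γ)
  cum_zero h Γ := taggedCum_untagged_of_eq (U.cum_zero h Γ)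
  one i Γ := untagged (U.one i Γ)
  one_sub i _ _ σ := sub_untagged_of_eq (U.one_sub i σ)
  El_one i Γ := El_code_untagged (U.El_one i Γ)
  cum_one h Γ := taggedCum_untagged_of_eq (U.cum_one h Γ)
  two i Γ := untagged (U.two i Γ)
  two_sub i _ _ σ := sub_untagged_of_eq (U.two_sub i σ)
  El_two i Γ := El_code_untagged (U.El_two i Γ)
  cum_two h Γ := taggedCum_untagged_of_eq (U.cum_two h Γ)

theorem taggedHierarchy_injectiveCodes : U.taggedHierarchy.InjectiveCodes where
  pi_injective := U.piBinder.tagged_injective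
  sg_injective := U.sgBinder.tagged_injective
  wt_injective := U.wtBinder.tagged_injective
  eq_injective := taggedEq_injective

variable (U) in
/-- The replacement of `U` by its tagged codes: `up` tags a code with a leaf, and `dec` forgets the
tag. -/
noncomputable def taggedReplacement : Replacement U U.taggedHierarchy where
  up := untagged
  up_sub := sub_untagged
  dec := code
  dec_sub := sub_code
  dec_up := code_untagged
  El_dec _ := rfl
  cum_up h _ a := taggedCum_untagged h a
  dec_cum h _ a := code_taggedCum h a
  dec_pi a b := U.piBinder.code_tagged a rfl b
  dec_sg a b := U.sgBinder.code_tagged a rfl b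
  dec_wt a b := U.wtBinder.code_tagged a rfl b
  dec_eq a s t := code_taggedEq a rfl s t
  dec_zero i Γ := code_untagged (U.zero i Γ)
  dec_one i Γ := code_untagged (U.one i Γ)
  dec_two i Γ := code_untagged (U.two i Γ)

namespace Replacement

variable {V : M.Hierarchy T} (R : Replacement U V)
include R

theorem El_up {i : ℕ} {Γ : C} (a : U.Code i Γ) : V.El (R.up a) = U.El a := by
  rw [R.El_dec, R.dec_up]

theorem isSmall_iff (i : ℕ) {Γ : C} (A : M.Ty Γ) : V.IsSmall i A ↔ U.IsSmall i A :=
  ⟨fun ⟨a, ha⟩ => ⟨R.dec a, (R.El_dec a).symm.trans ha⟩,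
    fun ⟨a, ha⟩ => ⟨R.up a, (R.El_up a).trans ha⟩⟩

theorem classified_eq (i : ℕ) : V.classified i = U.classified i :=
  le_antisymm (Universes.classified_le (R.dec (V.univCode i)) (R.El_dec _).symm)
    (Universes.classified_le (R.up (U.univCode i)) (R.El_up _))

end Replacement

end Hierarchy

end NatModel

theorem mainTheorem3 {C : Type u} [Category.{v} C] (M : NatModel.{u, v, w, w'} C)
    (T : M.ExtTT) (U : M.Hierarchy T) :
    ∃ V : M.Hierarchy T,
      V.InjectiveCodes ∧
      (∀ i : ℕ, V.classified i = U.classified i) ∧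
      (∀ (i : ℕ) (Γ : C) (A : M.Ty Γ), V.IsSmall i A ↔ U.IsSmall i A) ∧
      Nonempty (NatModel.Hierarchy.Replacement U V) := by
  let R := U.taggedReplacement
  exact ⟨U.taggedHierarchy, U.taggedHierarchy_injectiveCodes, R.classified_eq,
    fun i _ A => R.isSmall_iff i A, ⟨R⟩⟩
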